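/- Let $G$ be a connected Lie group and let $M=G/H$ be a reductive homogeneous manifold with a $G$-invariant Riemannian metric $g$. Let $\mathfrak m$ be the ($\mathrm{Ad}(H)$-invariant) orthogonal complement of $\mathfrak h=\mathrm{Lie}(H)$ in $\mathfrak g=\mathrm{Lie}(G)$ for an inner product $\langle\cdot,\cdot\rangle$ on $\mathfrak g$ which on $\mathfrak m\cong T_{o}(G/H)$, $o=eH$, is the one given by $g$. For $X\in\mathfrak m$ with $\mathrm{Ad}(h)X=X$ for all $h\in H$ and $\langle X,X\rangle<1$, let $\tilde X$ be the corresponding invariant vector field on $G/H$ and let $F_X(p,y)=\sqrt{g_p(y,y)}+g_p(\tilde X_p,y)$ be the corresponding invariant Randers metric. The formula of Deng and Hou asserts that, for all linearly independent $Y,U\in\mathfrak m$ and $P=\mathrm{span}\{Y,U\}$, the flag curvature of $F_X$ at $o$ is $$K(P,Y)=\frac{2\sqrt{\langle Y,Y\rangle}}{2\sqrt{\langle Y,Y\rangle}+\langle X,Y\rangle}\cdot\frac{\langle[[Y,U]_{\mathfrak h},Y],U\rangle}{\langle U,U\rangle\langle Y,Y\rangle-\langle U,Y\rangle^2},\qquad(\ast)$$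 where $[Y,U]_{\mathfrak h}$ is the orthogonal projection of $[Y,U]$ to $\mathfrak h$. Then: 1. The assertion that $(\ast)$ holds for all such $G$, $H$, $g$, $X$, $Y$, $U$ is false. 2. Let $G$ be a Lie group with a left-invariant Riemannian metric $g$, viewed as $G/\{e\}$ (so $\mathfrak h=0$ and $\mathfrak m=\mathfrak g$), and let $X=0$, which is an admissible choice. For every flag $(P,Y)$ at $e$, the flag curvature of $F_0$ is the sectional curvature of $g$ on $P$, while the right-hand side of $(\ast)$ is $0$. Hence, if $(\ast)$ holds for $(G,\{e\},g,0)$ and all flags at $e$, then all sectional curvatures of $(G,g)$, at all points, are zero. 3. Let $G$ be a connected non-abelian nilpotent Lie group. For every left-invariant Riemannian metric $g$ on $G$ there is a plane in $T_eG$ on which the sectional curvature of $g$ is nonzero; so $(\ast)$ fails for $(G,\{e\},g,0)$ and some flag. 4. The Heisenberg group (real $3\times3$ upper unitriangular matrices) is a connected non-abelian nilpotent Lie group and carries a left-invariant Riemannian metric; so it is such a counterexample. -/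

import Mathlib

open scoped Manifold ContDiff

noncomputable section

/-! ### Curvature computed in an open subset of a vector space -/

section Coordinates

variable {E : Type*} [NormedAddCommGroup E] [NormedSpace ℝ E]

/-- The fundamental tensor `g_y(u, v) = (1/2) ∂²/∂s∂t F²(z, y + s u + t v)` at `s = t = 0`,
of a Finsler function `F = F(z, y)` in coordinates. -/
def finslerTensor (F : E → E → ℝ) (z y : E) : E →L[ℝ] E →L[ℝ] ℝ :=
  (1 / 2 : ℝ) • fderiv ℝ (fderiv ℝ fun v => F z v ^ 2) y

/-- The geodesic spray coefficients of a Finsler function in coordinates,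
`Gⁱ = (1/4) gⁱˡ ((F²)_{xᵏ yˡ} yᵏ - (F²)_{xˡ})`; geodesics solve `c'' + 2 G(c, c') = 0`.
(`ContinuousLinearMap.inverse` is the inverse of an invertible map.) -/
def finslerSpray (F : E → E → ℝ) (z y : E) : E :=
  (finslerTensor F z y).inverse
    ((1 / 4 : ℝ) • (fderiv ℝ (fun z' => fderiv ℝ (fun v => F z' v ^ 2) y) z y
      - fderiv ℝ (fun z' => F z' y ^ 2) z))

/-- The Riemann curvature endomorphism `R_y` of a Finsler function in coordinates,
`Rⁱₖ = 2 ∂Gⁱ/∂xᵏ - yʲ ∂²Gⁱ/∂xʲ∂yᵏ + 2 Gʲ ∂²Gⁱ/∂yʲ∂yᵏ - ∂Gⁱ/∂yʲ ∂Gʲ/∂yᵏ`. -/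
def finslerRiemann (F : E → E → ℝ) (z y u : E) : E :=
  (2 : ℝ) • fderiv ℝ (fun z' => finslerSpray F z' y) z u
    - fderiv ℝ (fun z' => fderiv ℝ (finslerSpray F z') y u) z y
    + (2 : ℝ) • fderiv ℝ (fderiv ℝ (finslerSpray F z)) y (finslerSpray F z y) u
    - fderiv ℝ (finslerSpray F z) y (fderiv ℝ (finslerSpray F z) y u)

/-- The flag curvature, in coordinates, of the flag with flagpole `y` and plane `span {y, u}`. -/
def coordFlagCurvature (F : E → E → ℝ) (z y u : E) : ℝ :=
  finslerTensor F z y (finslerRiemann F z y u) u /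
    (finslerTensor F z y y y * finslerTensor F z y u u - finslerTensor F z y y u ^ 2)

/-- The Christoffel symbols of a Riemannian metric in coordinates, as a bilinear map:
`2 g(Γ(v, w), u) = (∂_v g)(w, u) + (∂_w g)(v, u) - (∂_u g)(v, w)`. -/
def christoffel (g : E → E →L[ℝ] E →L[ℝ] ℝ) (z v w : E) : E :=
  (g z).inverse
    ((1 / 2 : ℝ) • (fderiv ℝ g z v w + fderiv ℝ g z w v - ((fderiv ℝ g z).flip v).flip w))

/-- The curvature tensor `R(u, v) w = ∇_u ∇_v w - ∇_v ∇_u w` (for constant vector fields `u, v, w`)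
of the Levi-Civita connection of a Riemannian metric in coordinates. -/
def riemannTensor (g : E → E →L[ℝ] E →L[ℝ] ℝ) (z u v w : E) : E :=
  fderiv ℝ (fun z' => christoffel g z' v w) z u - fderiv ℝ (fun z' => christoffel g z' u w) z v
    + christoffel g z u (christoffel g z v w) - christoffel g z v (christoffel g z u w)

/-- The sectional curvature, in coordinates, of the plane `span {v, w}`. -/
def coordSectionalCurvature (g : E → E →L[ℝ] E →L[ℝ] ℝ) (z v w : E) : ℝ :=
  g z (riemannTensor g z v w w) v / (g z v v * g z w w - g z v w ^ 2)

end Coordinates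

/-! ### Curvature on manifolds -/

section Manifolds

variable {E : Type*} [NormedAddCommGroup E] [NormedSpace ℝ E]
  {M : Type*} [TopologicalSpace M] [ChartedSpace E M]

/-- The differential at `z` of the inverse of the preferred chart at `p`. -/
def chartSymmDeriv (p : M) (z : E) :
    E →L[ℝ] TangentSpace 𝓘(ℝ, E) ((extChartAt 𝓘(ℝ, E) p).symm z) :=
  mfderiv 𝓘(ℝ, E) 𝓘(ℝ, E) (extChartAt 𝓘(ℝ, E) p).symm z

/-- The coordinates of a tangent vector at `p` in the preferred chart at `p`. -/
def chartVec (p : M) (v : TangentSpace 𝓘(ℝ, E) p) : E :=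
  mfderiv 𝓘(ℝ, E) 𝓘(ℝ, E) (extChartAt 𝓘(ℝ, E) p) p v

/-- The flag curvature `K(P, Y)` at `p` of a Finsler function `F` on the tangent bundle of `M`,
for the flagpole `Y` and the plane `P = span {Y, U}`. -/
def flagCurvature (F : (x : M) → TangentSpace 𝓘(ℝ, E) x → ℝ) (p : M)
    (Y U : TangentSpace 𝓘(ℝ, E) p) : ℝ :=
  coordFlagCurvature
    (fun z v => F ((extChartAt 𝓘(ℝ, E) p).symm z) (chartSymmDeriv p z v))
    (extChartAt 𝓘(ℝ, E) p p) (chartVec p Y) (chartVec p U)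

variable [IsManifold 𝓘(ℝ, E) ∞ M]

variable (E M) in
/-- Smooth Riemannian metrics on `M`. -/
abbrev RiemMetric :=
  Bundle.ContMDiffRiemannianMetric 𝓘(ℝ, E) ∞ E (fun x : M => TangentSpace 𝓘(ℝ, E) x)

/-- The sectional curvature at `p` of the plane `span {Y, U}` of a Riemannian metric `g`. -/
def sectionalCurvature (g : RiemMetric E M) (p : M) (Y U : TangentSpace 𝓘(ℝ, E) p) : ℝ :=
  coordSectionalCurvature
    (fun z => ContinuousLinearMap.bilinearComp (E := E) (F := E) (G := ℝ)
      (g.inner ((extChartAt 𝓘(ℝ, E) p).symm z)) (chartSymmDeriv p z) (chartSymmDeriv p z))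
    (extChartAt 𝓘(ℝ, E) p p) (chartVec p Y) (chartVec p U)

/-- The Randers function `F(x, y) = √(g_x(y, y)) + g_x(X_x, y)` of a Riemannian metric `g` and a
vector field `X`. -/
def randers (g : RiemMetric E M) (X : (x : M) → TangentSpace 𝓘(ℝ, E) x) (x : M)
    (y : TangentSpace 𝓘(ℝ, E) x) : ℝ :=
  √(g.inner x y y) + g.inner x (X x) y

end Manifolds

/-! ### Reductive homogeneous Riemannian manifolds -/

section Homogeneous

variable {E : Type*} [NormedAddCommGroup E] [NormedSpace ℝ E]
  {G : Type*} [TopologicalSpace G] [ChartedSpace E G] [Group G]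

/-- The adjoint representation of a Lie group on its Lie algebra. -/
def adjointRep (a : G) : GroupLieAlgebra 𝓘(ℝ, E) G →ₗ[ℝ] GroupLieAlgebra 𝓘(ℝ, E) G :=
  letI L : E →L[ℝ] E := mfderiv 𝓘(ℝ, E) 𝓘(ℝ, E) (fun x : G => a * x * a⁻¹) 1
  L.toLinearMap

variable {E' : Type*} [NormedAddCommGroup E'] [NormedSpace ℝ E']
  {M : Type*} [TopologicalSpace M] [ChartedSpace E' M] [MulAction G M]

/-- The differential at the identity of the orbit map `G → M`, `a ↦ a • o`. -/
def orbitDeriv (o : M) : GroupLieAlgebra 𝓘(ℝ, E) G →ₗ[ℝ] TangentSpace 𝓘(ℝ, E') o :=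
  letI L : E →L[ℝ] E' := mfderiv 𝓘(ℝ, E) 𝓘(ℝ, E') (fun a : G => a • o) 1
  L.toLinearMap

variable (G) in
/-- A Riemannian metric on `M` is invariant if every `a : G` acts by an isometry. -/
def RiemMetric.IsInvariant [IsManifold 𝓘(ℝ, E') ∞ M] (g : RiemMetric E' M) : Prop :=
  ∀ (a : G) (x : M) (v w : TangentSpace 𝓘(ℝ, E') x),
    g.inner (a • x) (mfderiv 𝓘(ℝ, E') 𝓘(ℝ, E') (fun y : M => a • y) x v)
      (mfderiv 𝓘(ℝ, E') 𝓘(ℝ, E') (fun y : M => a • y) x w) = g.inner x v w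

variable (E G E' M) in
/-- A reductive homogeneous Riemannian manifold. The homogeneous manifold `G / H` is presented as a
manifold `M` with a smooth transitive action of `G` and a base point `o` with stabilizer `H`, the
orbit map `G → M` being a submersion, so that it induces a diffeomorphism `G / H ≃ M`. -/
structure ReductiveHomogeneousSpace [LieGroup 𝓘(ℝ, E) ∞ G] [IsManifold 𝓘(ℝ, E') ∞ M]
    [ContMDiffSMul 𝓘(ℝ, E) 𝓘(ℝ, E') ∞ G M] [MulAction.IsPretransitive G M] where
  /-- the base point -/
  o : M
  submersion : Function.Surjective (orbitDeriv (E := E) (G := G) (E' := E') o)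
  /-- the invariant Riemannian metric -/
  metric : RiemMetric E' M
  invariant : metric.IsInvariant G
  /-- an inner product on the Lie algebra of `G` -/
  B : LinearMap.BilinForm ℝ (GroupLieAlgebra 𝓘(ℝ, E) G)
  symm : ∀ v w, B v w = B w v
  pos : ∀ v, v ≠ 0 → 0 < B v v
  /-- The complement `m` of the Lie algebra of `H`. The latter is the tangent space at the identity
  of the fibre `H` of the orbit map, that is the kernel of its differential. -/
  m : Submodule ℝ (GroupLieAlgebra 𝓘(ℝ, E) G)
  isCompl : IsCompl (LinearMap.ker (orbitDeriv (E := E) (G := G) (E' := E') o)) m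
  orthogonal : ∀ v, v ∈ m ↔
    ∀ w ∈ LinearMap.ker (orbitDeriv (E := E) (G := G) (E' := E') o), B v w = 0
  ad_mem : ∀ a ∈ MulAction.stabilizer G o, ∀ v ∈ m, adjointRep a v ∈ m
  /-- On `m` the inner product is the one given by the metric on `T_o M`. -/
  compatible : ∀ v ∈ m, ∀ w ∈ m,
    B v w = metric.inner o (orbitDeriv (E := E) (G := G) (E' := E') o v)
      (orbitDeriv (E := E) (G := G) (E' := E') o w)

namespace ReductiveHomogeneousSpace

variable [LieGroup 𝓘(ℝ, E) ∞ G] [IsManifold 𝓘(ℝ, E') ∞ M]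
  [ContMDiffSMul 𝓘(ℝ, E) 𝓘(ℝ, E') ∞ G M] [MulAction.IsPretransitive G M]

/-- The isotropy group. -/
def H (D : ReductiveHomogeneousSpace E G E' M) : Subgroup G := MulAction.stabilizer G D.o

/-- The identification of `m` with `T_o M` (defined on the whole Lie algebra). -/
def toTangent (D : ReductiveHomogeneousSpace E G E' M) :
    GroupLieAlgebra 𝓘(ℝ, E) G →ₗ[ℝ] TangentSpace 𝓘(ℝ, E') D.o :=
  orbitDeriv D.o

/-- The Lie algebra of the isotropy group. -/
def h (D : ReductiveHomogeneousSpace E G E' M) : Submodule ℝ (GroupLieAlgebra 𝓘(ℝ, E) G) :=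
  LinearMap.ker (orbitDeriv (E := E) (G := G) (E' := E') D.o)

/-- The projection of the Lie algebra of `G` to `h` along its orthogonal complement `m`. -/
def projH (D : ReductiveHomogeneousSpace E G E' M) :
    GroupLieAlgebra 𝓘(ℝ, E) G →ₗ[ℝ] GroupLieAlgebra 𝓘(ℝ, E) G :=
  Submodule.projection D.h D.m D.isCompl

/-- The vectors `X` of `m` that are fixed by `Ad(H)` and satisfy `⟨X, X⟩ < 1`. -/
def V (D : ReductiveHomogeneousSpace E G E' M) : Set (GroupLieAlgebra 𝓘(ℝ, E) G) :=
  {X | X ∈ D.m ∧ (∀ a ∈ D.H, adjointRep a X = X) ∧ D.B X X < 1}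

/-- The vector field with value `d(a •) X` at `a • o`; it is the invariant vector field given
by `X` if `X` is fixed by `Ad(H)`, and then does not depend on the choice of `a`. -/
def invariantField (D : ReductiveHomogeneousSpace E G E' M) (X : GroupLieAlgebra 𝓘(ℝ, E) G)
    (x : M) : TangentSpace 𝓘(ℝ, E') x :=
  letI a : G := (MulAction.exists_smul_eq G D.o x).choose
  letI L : E' →L[ℝ] E' := mfderiv 𝓘(ℝ, E') 𝓘(ℝ, E') (fun y : M => a • y) D.o
  L (D.toTangent X)

/-- The invariant Randers function `F_X` given by `X`. -/
def randersFn (D : ReductiveHomogeneousSpace E G E' M) (X : GroupLieAlgebra 𝓘(ℝ, E) G) :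
    (x : M) → TangentSpace 𝓘(ℝ, E') x → ℝ :=
  randers D.metric (D.invariantField X)

/-- The right-hand side of the formula of Deng and Hou,
`2 √⟨Y,Y⟩ / (2 √⟨Y,Y⟩ + ⟨X,Y⟩) * K(P)` with
`K(P) = ⟨[[Y,U]_h, Y], U⟩ / (⟨U,U⟩ ⟨Y,Y⟩ - ⟨U,Y⟩²)`. -/
def dengHou (D : ReductiveHomogeneousSpace E G E' M) (X Y U : GroupLieAlgebra 𝓘(ℝ, E) G) : ℝ :=
  2 * √(D.B Y Y) / (2 * √(D.B Y Y) + D.B X Y) *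
    (D.B ⁅D.projH ⁅Y, U⁆, Y⁆ U / (D.B U U * D.B Y Y - D.B U Y ^ 2))

/-- The formula of Deng and Hou for the flag curvature of `F_X`, at all flags `(span {Y, U}, Y)`
in `m`. -/
def FlagFormula (D : ReductiveHomogeneousSpace E G E' M) (X : GroupLieAlgebra 𝓘(ℝ, E) G) : Prop :=
  ∀ Y ∈ D.m, ∀ U ∈ D.m, LinearIndependent ℝ ![Y, U] →
    flagCurvature (D.randersFn X) D.o (D.toTangent Y) (D.toTangent U) = D.dengHou X Y U

end ReductiveHomogeneousSpace

/-- The assertion of Deng and Hou: the flag curvature of every invariant Randers metric `F_X` on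
every reductive homogeneous Riemannian manifold is given by their formula. -/
def DengHouAssertion : Prop :=
  ∀ (E : Type) [NormedAddCommGroup E] [NormedSpace ℝ E] [FiniteDimensional ℝ E]
    (G : Type) [TopologicalSpace G] [ChartedSpace E G] [Group G] [LieGroup 𝓘(ℝ, E) ∞ G]
    [ConnectedSpace G]
    (E' : Type) [NormedAddCommGroup E'] [NormedSpace ℝ E'] [FiniteDimensional ℝ E']
    (M : Type) [TopologicalSpace M] [T2Space M] [ChartedSpace E' M] [IsManifold 𝓘(ℝ, E') ∞ M]
    [MulAction G M] [ContMDiffSMul 𝓘(ℝ, E) 𝓘(ℝ, E') ∞ G M] [MulAction.IsPretransitive G M]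
    (D : ReductiveHomogeneousSpace E G E' M),
    ∀ X ∈ D.V, D.FlagFormula X

/-! ### A Lie group as a homogeneous manifold with trivial isotropy -/

theorem orbitDeriv_one :
    orbitDeriv (E := E) (G := G) (E' := E) (1 : G) = LinearMap.id := by
  have h : (fun a : G => a • (1 : G)) = id := by ext a; simp
  ext v
  change mfderiv 𝓘(ℝ, E) 𝓘(ℝ, E) (fun a : G => a • (1 : G)) 1 v = v
  rw [h]
  exact congrArg (fun L : E →L[ℝ] E => L v) (mfderiv_id (I := 𝓘(ℝ, E)) (x := (1 : G)))

/-- The Lie group `G` with a left-invariant Riemannian metric, as a reductive homogeneous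
manifold `G / {e}`, with `h = 0` and `m` the whole Lie algebra. -/
def lieGroupSpace [LieGroup 𝓘(ℝ, E) ∞ G] (g : RiemMetric E G) (hg : g.IsInvariant G) :
    ReductiveHomogeneousSpace E G E G where
  o := 1
  submersion := by rw [orbitDeriv_one]; exact Function.surjective_id
  metric := g
  invariant := hg
  B := LinearMap.mk₂ ℝ (fun v w => g.inner (1 : G) v w)
    (by intro u v w; simp) (by intro c v w; simp) (by intro u v w; simp) (by intro c v w; simp)
  symm := fun v w => g.symm 1 v w
  pos := fun v hv => g.pos 1 v hv
  m := ⊤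
  isCompl := by rw [orbitDeriv_one, LinearMap.ker_id]; exact isCompl_bot_top
  orthogonal := by
    intro v
    rw [orbitDeriv_one, LinearMap.ker_id]
    simp
  ad_mem := fun _ _ _ _ => Submodule.mem_top
  compatible := by
    intro v _ w _
    rw [orbitDeriv_one]
    rfl

end Homogeneous

/-! ### The Heisenberg group -/

/-- The Heisenberg group: the triple `(a, b, c)` stands for the real upper unitriangular matrix with
rows `(1, a, c)`, `(0, 1, b)`, `(0, 0, 1)`. -/
def Heisenberg : Type := EuclideanSpace ℝ (Fin 3)

namespace Heisenberg

instance : TopologicalSpace Heisenberg := inferInstanceAs (TopologicalSpace (EuclideanSpace ℝ (Fin 3)))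

instance : ChartedSpace (EuclideanSpace ℝ (Fin 3)) Heisenberg :=
  inferInstanceAs (ChartedSpace (EuclideanSpace ℝ (Fin 3)) (EuclideanSpace ℝ (Fin 3)))

/-- The product of two unitriangular matrices. -/
def mulFn (p q : EuclideanSpace ℝ (Fin 3)) : EuclideanSpace ℝ (Fin 3) :=
  !₂[p 0 + q 0, p 1 + q 1, p 2 + q 2 + p 0 * q 1]

/-- The inverse of a unitriangular matrix. -/
def invFn (p : EuclideanSpace ℝ (Fin 3)) : EuclideanSpace ℝ (Fin 3) :=
  !₂[-p 0, -p 1, -p 2 + p 0 * p 1]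

theorem mulFn_assoc (p q r : EuclideanSpace ℝ (Fin 3)) :
    mulFn (mulFn p q) r = mulFn p (mulFn q r) := by
  ext i
  fin_cases i <;> simp [mulFn] <;> ring

theorem zero_mulFn (p : EuclideanSpace ℝ (Fin 3)) : mulFn 0 p = p := by
  ext i
  fin_cases i <;> simp [mulFn]

theorem mulFn_zero (p : EuclideanSpace ℝ (Fin 3)) : mulFn p 0 = p := by
  ext i
  fin_cases i <;> simp [mulFn]

theorem invFn_mulFn (p : EuclideanSpace ℝ (Fin 3)) : mulFn (invFn p) p = 0 := by
  ext i
  fin_cases i <;> simp [mulFn, invFn]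

instance : Group Heisenberg where
  mul := mulFn
  one := (0 : EuclideanSpace ℝ (Fin 3))
  inv := invFn
  mul_assoc := mulFn_assoc
  one_mul := zero_mulFn
  mul_one := mulFn_zero
  inv_mul_cancel := invFn_mulFn

theorem contDiff_mulFn : ContDiff ℝ ∞
    (fun p : EuclideanSpace ℝ (Fin 3) × EuclideanSpace ℝ (Fin 3) => mulFn p.1 p.2) := by
  rw [contDiff_euclidean]
  intro i
  fin_cases i <;> simp [mulFn] <;> fun_prop

theorem contDiff_invFn : ContDiff ℝ ∞ invFn := by
  rw [contDiff_euclidean]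
  intro i
  fin_cases i <;> simp [invFn] <;> fun_prop

instance : IsManifold 𝓘(ℝ, EuclideanSpace ℝ (Fin 3)) ∞ Heisenberg :=
  inferInstanceAs (IsManifold 𝓘(ℝ, EuclideanSpace ℝ (Fin 3)) ∞ (EuclideanSpace ℝ (Fin 3)))

theorem contMDiff_mulFn :
    ContMDiff (𝓘(ℝ, EuclideanSpace ℝ (Fin 3)).prod 𝓘(ℝ, EuclideanSpace ℝ (Fin 3)))
      𝓘(ℝ, EuclideanSpace ℝ (Fin 3)) ∞
      (fun p : EuclideanSpace ℝ (Fin 3) × EuclideanSpace ℝ (Fin 3) => mulFn p.1 p.2) := by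
  rw [← modelWithCornersSelf_prod, chartedSpaceSelf_prod]
  exact contDiff_mulFn.contMDiff

instance : LieGroup 𝓘(ℝ, EuclideanSpace ℝ (Fin 3)) ∞ Heisenberg where
  contMDiff_mul := contMDiff_mulFn
  contMDiff_inv := contDiff_invFn.contMDiff

end Heisenberg

end

/-! Take `H = {e}` and `X = 0`. Then `𝔥 = 0`, so the right-hand side of the formula vanishes, while
`F_0` is the norm of `g`, whose flag curvature is the sectional curvature of `g`. The formula would
therefore force every left-invariant metric to be flat at the identity, hence everywhere by
homogeneity. It remains to find left-invariant metrics that are not flat.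

All curvatures are computed in a left-invariant frame `P` in a chart: there `g` has constant
coefficients `B` and the frame fields have constant structure coefficients `c`
(`isInvariantFrame_leftFrame`). The Koszul formula then expresses the connection and the curvature
algebraically in `B` and `c` (`christoffel_eq`, `riemannTensor_eq`), independently of the point.

Let `Z` be central in the Lie algebra. The Koszul formula and vanishing torsion give `⟨R(Z,U)U, Z⟩ =
|∇_Z U|²`, so flatness implies `∇_Z = 0`, which by the Koszul formula says that `Z` is orthogonal to
all brackets (`apply_bracket_eq_zero_of_flat`). A contradiction needs a central `Z` that is not
orthogonal to the derived algebra.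

Such a `Z` comes from nilpotency of the group itself. The differential at `1` of `b ↦ b⁻¹ a b a⁻¹`
is `Ad(a) - 1`, so all sufficiently long products of operators `Ad(a) - 1` vanish. A nonzero value
`Z = Ad(a) W - W` of a longest nonvanishing product is fixed by `Ad` (`exists_chartAd_invariant`),
hence central. If `⟨·, Z⟩` kills all brackets, it is `Ad`-invariant because `G` is connected
(`apply_chartAd_of_chartBracket`), so `⟨Z, Z⟩ = ⟨Ad(a) W - W, Z⟩ = 0`, which is absurd. -/

open Filter Topology

/-! ### Curvature of a metric with constant coefficients in a frame -/

section CoordinateCurvature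

variable {E F : Type*} [NormedAddCommGroup E] [NormedSpace ℝ E] [NormedAddCommGroup F]
  [NormedSpace ℝ F]

theorem ContinuousLinearMap.isInvertible_of_pos [FiniteDimensional ℝ E] {B : E →L[ℝ] E →L[ℝ] ℝ}
    (pos : ∀ v, v ≠ 0 → 0 < B v v) : B.IsInvertible := by
  have inj : Function.Injective (LinearMap.toContinuousLinearMap.symm.toLinearMap ∘ₗ
      B.toLinearMap : E →ₗ[ℝ] E →ₗ[ℝ] ℝ) := by
    rw [← LinearMap.ker_eq_bot, LinearMap.ker_eq_bot']
    intro v hv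
    by_contra h
    have h1 : B v v = 0 := congrArg (fun f : E →ₗ[ℝ] ℝ => f v) hv
    exact (pos v h).ne' h1
  let e : E ≃ₗ[ℝ] (E →L[ℝ] ℝ) :=
    (LinearMap.linearEquivOfInjective _ inj (Subspace.dual_finrank_eq (K := ℝ) (V := E)).symm).trans
      LinearMap.toContinuousLinearMap
  exact ⟨e.toContinuousLinearEquiv, by ext v w; rfl⟩

theorem ContinuousLinearMap.isInvertible_of_injective [FiniteDimensional ℝ E] {f : E →L[ℝ] E}
    (hf : Function.Injective f) : f.IsInvertible :=
  ⟨(LinearEquiv.ofInjectiveEndo f.toLinearMap hf).toContinuousLinearEquiv, by ext v; rfl⟩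

theorem ContinuousLinearMap.IsInvertible.eventually [CompleteSpace E] {P : E → E →L[ℝ] E} {z₀ : E}
    (h : (P z₀).IsInvertible) (hP : ContinuousAt P z₀) : ∀ᶠ z in 𝓝 z₀, (P z).IsInvertible := by
  obtain ⟨e, he⟩ := h
  exact hP (by rw [← he]; exact ContinuousLinearEquiv.nhds e)

/-- The Levi-Civita connection, on left-invariant vector fields, of the left-invariant metric given
by the inner product `B` on a Lie algebra with bracket `c`. -/
noncomputable def koszulMap [FiniteDimensional ℝ E] (B : E →L[ℝ] E →L[ℝ] ℝ)
    (c : E →L[ℝ] E →L[ℝ] E) : E →L[ℝ] E →L[ℝ] E :=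
  (LinearMap.mk₂ ℝ (fun U V => B.inverse ((1 / 2 : ℝ) • (B (c U V) - B V ∘L c U - B U ∘L c V)))
    (by
      intro U U' V
      rw [← map_add]
      congr 1
      ext W
      simp
      ring)
    (by
      intro a U V
      rw [← map_smul]
      congr 1
      ext W
      simp
      ring)
    (by
      intro U U' V
      rw [← map_add]
      congr 1
      ext W
      simp
      ring)
    (by
      intro a U V
      rw [← map_smul]
      congr 1
      ext W
      simp
      ring)).toContinuousBilinearMap

theorem apply_koszulMap [FiniteDimensional ℝ E] {B : E →L[ℝ] E →L[ℝ] ℝ} (hB : B.IsInvertible)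
    (c : E →L[ℝ] E →L[ℝ] E) (U V W : E) :
    B (koszulMap B c U V) W = 1 / 2 * (B (c U V) W - B V (c U W) - B U (c V W)) := by
  obtain ⟨e, rfl⟩ := hB
  simp [koszulMap]

/-- The curvature tensor, on left-invariant vector fields, of the left-invariant metric given
by the inner product `B` on a Lie algebra with bracket `c`. -/
noncomputable def koszulCurvature [FiniteDimensional ℝ E] (B : E →L[ℝ] E →L[ℝ] ℝ)
    (c : E →L[ℝ] E →L[ℝ] E) (U V W : E) : E :=
  koszulMap B c U (koszulMap B c V W) - koszulMap B c V (koszulMap B c U W)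
    - koszulMap B c (c U V) W

/-! ### Algebraic identities for the Koszul connection -/

section Algebra

variable [FiniteDimensional ℝ E] {B : E →L[ℝ] E →L[ℝ] ℝ} {c : E →L[ℝ] E →L[ℝ] E}

theorem koszulMap_skew (symm : ∀ v w, B v w = B w v) (pos : ∀ v, v ≠ 0 → 0 < B v v)
    (anti : ∀ U V, c U V = -c V U) (U V W : E) : B (koszulMap B c U V) W = -B (koszulMap B c U W) V := by
  have hB := ContinuousLinearMap.isInvertible_of_pos pos
  rw [apply_koszulMap hB, apply_koszulMap hB, anti V W, symm (c U V) W, symm (c U W) V]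
  simp
  ring

theorem koszulMap_sub (pos : ∀ v, v ≠ 0 → 0 < B v v)
    (anti : ∀ U V, c U V = -c V U) (U V : E) : koszulMap B c U V - koszulMap B c V U = c U V := by
  have hB := ContinuousLinearMap.isInvertible_of_pos pos
  obtain ⟨e, he⟩ := id hB
  apply e.injective
  ext W
  change (e : E →L[ℝ] E →L[ℝ] ℝ) _ W = (e : E →L[ℝ] E →L[ℝ] ℝ) _ W
  rw [he, map_sub, sub_apply, apply_koszulMap hB, apply_koszulMap hB, anti V U]
  simp
  ring

theorem koszulCurvature_skew (symm : ∀ v w, B v w = B w v)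
    (pos : ∀ v, v ≠ 0 → 0 < B v v) (anti : ∀ U V, c U V = -c V U) (U V W X : E) :
    B (koszulCurvature B c U V W) X = -B (koszulCurvature B c U V X) W := by
  have sk := koszulMap_skew symm pos anti
  simp only [koszulCurvature, map_sub, sub_apply]
  rw [sk U _ X, sk V _ X, sk _ W X, symm _ (koszulMap B c V W), symm _ (koszulMap B c U W),
    sk V W, sk U W]
  ring

theorem koszulCurvature_swap (anti : ∀ U V, c U V = -c V U) (U V W : E) :
    koszulCurvature B c U V W = -koszulCurvature B c V U W := by
  simp only [koszulCurvature]
  rw [anti U V]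
  simp
  abel

/-- A left-invariant metric is not flat if there is a central element of the Lie algebra that is not
orthogonal to the derived algebra. -/
theorem apply_bracket_eq_zero_of_flat (symm : ∀ v w, B v w = B w v)
    (pos : ∀ v, v ≠ 0 → 0 < B v v) (anti : ∀ U V, c U V = -c V U) {Z : E} (hZ : ∀ U, c Z U = 0)
    (flat : ∀ U, LinearIndependent ℝ ![Z, U] → B (koszulCurvature B c Z U U) Z = 0) (U V : E) :
    B (c U V) Z = 0 := by
  have hB := ContinuousLinearMap.isInvertible_of_pos pos
  have sk := koszulMap_skew symm pos anti
  have key : ∀ U, koszulMap B c Z U = 0 := by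
    intro U
    -- Every term of the Koszul formula here contains a bracket with the central element `Z`.
    have zz : ∀ W, B (koszulMap B c Z W) Z = 0 := by
      intro W
      rw [apply_koszulMap hB, hZ, anti W Z]
      simp [hZ]
    by_cases li : LinearIndependent ℝ ![Z, U]
    · have h := flat U li
      have zu : koszulMap B c U Z = koszulMap B c Z U := by
        have := koszulMap_sub pos anti Z U
        rw [hZ] at this
        exact (sub_eq_zero.1 this).symm
      -- Only `-⟨∇_U ∇_Z U, Z⟩ = ⟨∇_Z U, ∇_U Z⟩` survives, and `∇_U Z = ∇_Z U`; so `h` becomes `|∇_Z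
      -- U|² = 0`.
      simp only [koszulCurvature, map_sub, sub_apply, hZ, map_zero,
        zero_apply, zz, sk U _ Z, zu, zero_sub, neg_neg, sub_zero] at h
      by_contra hne
      exact (pos _ hne).ne' h
    -- Flatness says nothing about dependent pairs, but for these `∇_Z Z = 0` follows from the
    -- Koszul formula.
    · by_cases hz : Z = 0
      · simp [hz]
      · rw [LinearIndependent.pair_iff' hz] at li
        push Not at li
        obtain ⟨a, rfl⟩ := li
        have : koszulMap B c Z Z = 0 := by
          obtain ⟨e, he⟩ := id hB
          apply e.injective
          ext W
          change (e : E →L[ℝ] E →L[ℝ] ℝ) _ W = (e : E →L[ℝ] E →L[ℝ] ℝ) _ W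
          rw [he, apply_koszulMap hB, hZ, hZ]
          simp
        simp [this]
  have h := apply_koszulMap hB c Z U V
  rw [key, hZ, hZ, symm] at h
  rw [symm]
  simpa using h

end Algebra

/-- A smooth frame `P` near `z₀` in which the metric `g` has the constant coefficients `B`, and
the constant structure coefficients `c`. -/
structure IsInvariantFrame (g : E → E →L[ℝ] E →L[ℝ] ℝ) (P : E → E →L[ℝ] E)
    (B : E →L[ℝ] E →L[ℝ] ℝ) (c : E →L[ℝ] E →L[ℝ] E) (z₀ : E) : Prop where
  contDiff : ContDiffAt ℝ 2 P z₀
  isInvertible : (P z₀).IsInvertible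
  metric : ∀ᶠ z in 𝓝 z₀, ∀ U V, g z (P z U) (P z V) = B U V
  bracket : ∀ᶠ z in 𝓝 z₀, ∀ U V,
    fderiv ℝ P z (P z U) V - fderiv ℝ P z (P z V) U = P z (c U V)

/-! ### The Levi-Civita connection in an invariant frame -/

namespace IsInvariantFrame

variable {g : E → E →L[ℝ] E →L[ℝ] ℝ} {P : E → E →L[ℝ] E}
  {B : E →L[ℝ] E →L[ℝ] ℝ} {c : E →L[ℝ] E →L[ℝ] E} {z₀ : E}

theorem metric_eq (h : IsInvariantFrame g P B c z₀) (v w : E) :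
    g z₀ v w = B ((P z₀).inverse v) ((P z₀).inverse w) := by
  rw [← h.metric.self_of_nhds, h.isInvertible.self_apply_inverse, h.isInvertible.self_apply_inverse]

theorem symm (h : IsInvariantFrame g P B c z₀) (symm : ∀ v w, B v w = B w v) (v w : E) :
    g z₀ v w = g z₀ w v := by
  rw [h.metric_eq, h.metric_eq, symm]

theorem pos (h : IsInvariantFrame g P B c z₀) (pos : ∀ v, v ≠ 0 → 0 < B v v) (v : E) (hv : v ≠ 0) :
    0 < g z₀ v v := by
  rw [h.metric_eq]
  refine pos _ fun h0 => hv ?_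
  rw [← h.isInvertible.self_apply_inverse v, h0, map_zero]

variable [FiniteDimensional ℝ E]

/-- Each condition persists near `z₀`, so identities proved at one point hold on a neighbourhood and
can be differentiated. -/
theorem eventually (h : IsInvariantFrame g P B c z₀) :
    ∀ᶠ z in 𝓝 z₀, IsInvariantFrame g P B c z := by
  have := FiniteDimensional.complete ℝ E
  filter_upwards [h.contDiff.eventually (by simp), h.isInvertible.eventually h.contDiff.continuousAt,
    h.metric.eventually_nhds, h.bracket.eventually_nhds] with z a1 a2 a3 a4
  exact ⟨a1, a2, a3, a4⟩

theorem contDiffAt_inverse (h : IsInvariantFrame g P B c z₀) :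
    ContDiffAt ℝ 2 (fun z => (P z).inverse) z₀ := by
  have := FiniteDimensional.complete ℝ E
  exact h.isInvertible.contDiffAt_map_inverse.comp z₀ h.contDiff

theorem contDiffAt_metric (h : IsInvariantFrame g P B c z₀) : ContDiffAt ℝ 2 g z₀ := by
  have hi := h.contDiffAt_inverse
  have : ContDiffAt ℝ 2 (fun z => ((ContinuousLinearMap.compL ℝ E E ℝ).flip (P z).inverse).comp
      (B.comp (P z).inverse)) z₀ :=
    ((ContinuousLinearMap.contDiff _).contDiffAt.comp z₀ hi).clm_comp (contDiffAt_const.clm_comp hi)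
  refine this.congr_of_eventuallyEq ?_
  filter_upwards [h.eventually] with z hz
  ext v w
  exact hz.metric_eq v w

/-- Product rule for the constant function `g(P V, P W)`. -/
theorem fderiv_metric (h : IsInvariantFrame g P B c z₀) (u V W : E) :
    fderiv ℝ g z₀ u (P z₀ V) (P z₀ W)
      = -(g z₀ (fderiv ℝ P z₀ u V) (P z₀ W) + g z₀ (P z₀ V) (fderiv ℝ P z₀ u W)) := by
  have hg := (h.contDiffAt_metric.differentiableAt (by simp)).hasFDerivAt
  have hP := (h.contDiff.differentiableAt (by simp)).hasFDerivAt
  have h1 := (hg.clm_apply (hP.clm_apply (hasFDerivAt_const V z₀))).clm_apply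
    (hP.clm_apply (hasFDerivAt_const W z₀))
  have h2 : HasFDerivAt (fun z => g z (P z V) (P z W)) (0 : E →L[ℝ] ℝ) z₀ :=
    (hasFDerivAt_const (B V W) z₀).congr_of_eventuallyEq (h.metric.mono fun z hz => hz V W)
  have h3 := congrArg (fun f => f u) (h1.unique h2)
  simp at h3
  linarith

/-- This is `∇_{PU}(PV) = P(∇_U V)` with the left side expanded in coordinates. Pairing with `P W`,
the derivatives of `g` turn into derivatives of `P`, and the bracket relation leaves only the Koszul
terms. -/
theorem christoffel_eq (h : IsInvariantFrame g P B c z₀) (symm : ∀ v w, B v w = B w v)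
    (pos : ∀ v, v ≠ 0 → 0 < B v v) (U V : E) :
    christoffel g z₀ (P z₀ U) (P z₀ V)
      = P z₀ (koszulMap B c U V) - fderiv ℝ P z₀ (P z₀ U) V := by
  have hg := ContinuousLinearMap.isInvertible_of_pos (h.pos pos)
  rw [christoffel, hg.inverse_apply_eq]
  ext w
  obtain ⟨W, rfl⟩ : ∃ W, P z₀ W = w := ⟨_, h.isInvertible.self_apply_inverse w⟩
  have m := h.metric.self_of_nhds
  have b := h.bracket.self_of_nhds
  have e1 : g z₀ (fderiv ℝ P z₀ (P z₀ V) U) (P z₀ W)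
      = g z₀ (fderiv ℝ P z₀ (P z₀ U) V) (P z₀ W) - B (c U V) W := by
    rw [← m, ← b]
    simp
  have e2 : g z₀ (P z₀ V) (fderiv ℝ P z₀ (P z₀ W) U)
      = g z₀ (P z₀ V) (fderiv ℝ P z₀ (P z₀ U) W) - B V (c U W) := by
    rw [← m, ← b]
    simp
  have e3 : g z₀ (P z₀ U) (fderiv ℝ P z₀ (P z₀ W) V)
      = g z₀ (P z₀ U) (fderiv ℝ P z₀ (P z₀ V) W) - B U (c V W) := by
    rw [← m, ← b]
    simp
  have s := h.symm symm
  simp only [smul_apply, add_apply, sub_apply, map_sub,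
    ContinuousLinearMap.flip_apply, h.fderiv_metric, m,
    apply_koszulMap (ContinuousLinearMap.isInvertible_of_pos pos), smul_eq_mul]
  rw [e1, s _ (P z₀ V), e2, e3]
  ring

theorem christoffel_eq' (h : IsInvariantFrame g P B c z₀) (symm : ∀ v w, B v w = B w v)
    (pos : ∀ v, v ≠ 0 → 0 < B v v) (v w : E) :
    christoffel g z₀ v w = P z₀ (koszulMap B c ((P z₀).inverse v) ((P z₀).inverse w))
      - fderiv ℝ P z₀ v ((P z₀).inverse w) := by
  have := h.christoffel_eq symm pos ((P z₀).inverse v) ((P z₀).inverse w)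
  rwa [h.isInvertible.self_apply_inverse, h.isInvertible.self_apply_inverse] at this

theorem fderiv_inverse (h : IsInvariantFrame g P B c z₀) (u V : E) :
    fderiv ℝ (fun z => (P z).inverse) z₀ u (P z₀ V) = -(P z₀).inverse (fderiv ℝ P z₀ u V) := by
  have hi := (h.contDiffAt_inverse.differentiableAt (by simp)).hasFDerivAt
  have hP := (h.contDiff.differentiableAt (by simp)).hasFDerivAt
  have h1 := hi.clm_apply (hP.clm_apply (hasFDerivAt_const V z₀))
  have h2 : HasFDerivAt (fun z => (P z).inverse (P z V)) (0 : E →L[ℝ] E) z₀ :=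
    (hasFDerivAt_const V z₀).congr_of_eventuallyEq
      (h.eventually.mono fun z hz => hz.isInvertible.inverse_apply_self V)
  have h3 := congrArg (fun f => f u) (h1.unique h2)
  simp at h3
  exact eq_neg_of_add_eq_zero_right h3

/-- The arguments `P z₀ V` and `P z₀ W` stay fixed as `z` moves, so their frame components `(P z)⁻¹
(P z₀ V)` vary and contribute the terms with the inverse of `P`. -/
theorem fderiv_christoffel (h : IsInvariantFrame g P B c z₀) (symm : ∀ v w, B v w = B w v)
    (pos : ∀ v, v ≠ 0 → 0 < B v v) (u V W : E) :
    fderiv ℝ (fun z => christoffel g z (P z₀ V) (P z₀ W)) z₀ u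
      = fderiv ℝ P z₀ u (koszulMap B c V W)
        - P z₀ (koszulMap B c ((P z₀).inverse (fderiv ℝ P z₀ u V)) W)
        - P z₀ (koszulMap B c V ((P z₀).inverse (fderiv ℝ P z₀ u W)))
        - fderiv ℝ (fderiv ℝ P) z₀ u (P z₀ V) W
        + fderiv ℝ P z₀ (P z₀ V) ((P z₀).inverse (fderiv ℝ P z₀ u W)) := by
  have hi := (h.contDiffAt_inverse.differentiableAt (by simp)).hasFDerivAt
  have hP := (h.contDiff.differentiableAt (by simp)).hasFDerivAt
  have hdP := ((h.contDiff.fderiv_right (m := 1) le_rfl).differentiableAt (by simp)).hasFDerivAt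
  have hv := hi.clm_apply (hasFDerivAt_const (P z₀ V) z₀)
  have hw := hi.clm_apply (hasFDerivAt_const (P z₀ W) z₀)
  have h1 := (hP.clm_apply (((koszulMap B c).hasFDerivAt.comp z₀ hv).clm_apply hw)).sub
    ((hdP.clm_apply (hasFDerivAt_const (P z₀ V) z₀)).clm_apply hw)
  have h2 := h1.congr_of_eventuallyEq
    (h.eventually.mono fun z hz => hz.christoffel_eq' symm pos (P z₀ V) (P z₀ W))
  rw [h2.fderiv]
  simp [h.fderiv_inverse, h.isInvertible.inverse_apply_self]
  abel

/-- The second derivatives of `P` cancel by symmetry; the remaining first-derivative terms combine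
to `∇_{[U,V]} W`. -/
theorem riemannTensor_eq (h : IsInvariantFrame g P B c z₀) (symm : ∀ v w, B v w = B w v)
    (pos : ∀ v, v ≠ 0 → 0 < B v v) (U V W : E) :
    riemannTensor g z₀ (P z₀ U) (P z₀ V) (P z₀ W) = P z₀ (koszulCurvature B c U V W) := by
  have hs : fderiv ℝ (fderiv ℝ P) z₀ (P z₀ U) (P z₀ V) = fderiv ℝ (fderiv ℝ P) z₀ (P z₀ V) (P z₀ U) :=
    (h.contDiff.isSymmSndFDerivAt (by simp)) _ _
  have b : ∀ U V, c U V = (P z₀).inverse (fderiv ℝ P z₀ (P z₀ U) V)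
      - (P z₀).inverse (fderiv ℝ P z₀ (P z₀ V) U) := by
    intro U V
    rw [← map_sub, h.bracket.self_of_nhds, h.isInvertible.inverse_apply_self]
  have q : ∀ x, (P z₀).inverse (P z₀ x) = x := h.isInvertible.inverse_apply_self
  rw [riemannTensor, h.fderiv_christoffel symm pos, h.fderiv_christoffel symm pos, hs,
    h.christoffel_eq symm pos, h.christoffel_eq symm pos, h.christoffel_eq' symm pos,
    h.christoffel_eq' symm pos, koszulCurvature, b]
  simp only [map_sub, sub_apply, q]
  abel

theorem coordSectionalCurvature_eq (h : IsInvariantFrame g P B c z₀)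
    (symm : ∀ v w, B v w = B w v) (pos : ∀ v, v ≠ 0 → 0 < B v v) (U V : E) :
    coordSectionalCurvature g z₀ (P z₀ U) (P z₀ V)
      = B (koszulCurvature B c U V V) U / (B U U * B V V - B U V ^ 2) := by
  rw [coordSectionalCurvature, h.riemannTensor_eq symm pos]
  simp only [h.metric.self_of_nhds]

end IsInvariantFrame

/-! ### Finsler curvature of the norm of a Riemannian metric -/

theorem fderiv_apply_self (b : E →L[ℝ] E →L[ℝ] F) (y : E) :
    fderiv ℝ (fun v => b v v) y = b y + b.flip y := by
  have h := (b.hasFDerivAt (x := y)).clm_apply (hasFDerivAt_id y)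
  change fderiv ℝ (fun v => b v (id v)) y = _
  rw [h.fderiv]
  ext v
  simp

theorem fderiv_fderiv_apply_self (b : E →L[ℝ] E →L[ℝ] F) (y : E) :
    fderiv ℝ (fderiv ℝ fun v => b v v) y = b + b.flip := by
  have : (fderiv ℝ fun v => b v v) = (b + b.flip : E →L[ℝ] E →L[ℝ] F) := by
    ext1 v
    exact fderiv_apply_self b v
  rw [this, ContinuousLinearMap.fderiv]

namespace IsInvariantFrame

variable {g : E → E →L[ℝ] E →L[ℝ] ℝ} {P : E → E →L[ℝ] E}
  {B : E →L[ℝ] E →L[ℝ] ℝ} {c : E →L[ℝ] E →L[ℝ] E} {z₀ : E} {F : E → E → ℝ}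

theorem finslerTensor_eq (h : IsInvariantFrame g P B c z₀) (symm : ∀ v w, B v w = B w v)
    (hF : ∀ z v, F z v ^ 2 = g z v v) (y : E) : finslerTensor F z₀ y = g z₀ := by
  have h1 : (g z₀).flip = g z₀ := by
    ext v w
    exact h.symm symm w v
  rw [finslerTensor]
  simp only [hF, fderiv_fderiv_apply_self, h1]
  rw [← two_smul ℝ, smul_smul]
  norm_num

variable [FiniteDimensional ℝ E]

theorem finslerSpray_eq (h : IsInvariantFrame g P B c z₀) (symm : ∀ v w, B v w = B w v)
    (hF : ∀ z v, F z v ^ 2 = g z v v) (y : E) :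
    finslerSpray F z₀ y = (1 / 2 : ℝ) • christoffel g z₀ y y := by
  have hg := (h.contDiffAt_metric.differentiableAt (by simp)).hasFDerivAt
  have e1 : HasFDerivAt (fun z => fderiv ℝ (fun v => F z v ^ 2) y)
      ((2 : ℝ) • (fderiv ℝ g z₀).flip y) z₀ := by
    refine ((hg.clm_apply (hasFDerivAt_const y z₀)).const_smul (2 : ℝ)).congr_of_eventuallyEq ?_
      |>.congr_fderiv (by ext; simp)
    filter_upwards [h.eventually] with z hz
    have h1 : (g z).flip = g z := by
      ext v w
      exact hz.symm symm w v
    simp only [hF, fderiv_apply_self, h1]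
    rw [← two_smul ℝ]
    rfl
  have e2 : HasFDerivAt (fun z => F z y ^ 2) (((fderiv ℝ g z₀).flip y).flip y) z₀ := by
    simp only [hF]
    exact ((hg.clm_apply (hasFDerivAt_const y z₀)).clm_apply
      (hasFDerivAt_const y z₀)).congr_fderiv (by ext; simp)
  rw [finslerSpray, h.finslerTensor_eq symm hF, e1.fderiv, e2.fderiv, christoffel,
    ← map_smul (g z₀).inverse]
  refine congrArg (g z₀).inverse ?_
  ext v
  simp
  ring

theorem christoffel_symm (h : IsInvariantFrame g P B c z₀) (symm : ∀ v w, B v w = B w v) (v w : E) :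
    christoffel g z₀ v w = christoffel g z₀ w v := by
  have h1 : ((fderiv ℝ g z₀).flip v).flip w = ((fderiv ℝ g z₀).flip w).flip v := by
    ext u
    obtain ⟨V, rfl⟩ : ∃ V, P z₀ V = v := ⟨_, h.isInvertible.self_apply_inverse v⟩
    obtain ⟨W, rfl⟩ : ∃ W, P z₀ W = w := ⟨_, h.isInvertible.self_apply_inverse w⟩
    simp only [ContinuousLinearMap.flip_apply, h.fderiv_metric]
    rw [h.symm symm _ (P z₀ W), h.symm symm (P z₀ V), add_comm]
  rw [christoffel, christoffel, h1, add_comm (fderiv ℝ g z₀ v w)]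

/-- The Christoffel symbols at `z₀`, as a continuous bilinear map. -/
theorem exists_christoffel (h : IsInvariantFrame g P B c z₀) (symm : ∀ v w, B v w = B w v)
    (pos : ∀ v, v ≠ 0 → 0 < B v v) :
    ∃ Γ : E →L[ℝ] E →L[ℝ] E, ∀ v w, christoffel g z₀ v w = Γ v w := by
  refine ⟨(ContinuousLinearMap.compL ℝ E E E (P z₀)).comp
      ((koszulMap B c).bilinearComp (P z₀).inverse (P z₀).inverse)
    - (fderiv ℝ P z₀).bilinearComp (.id ℝ E) (P z₀).inverse, fun v w => ?_⟩
  rw [h.christoffel_eq' symm pos]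
  simp

theorem fderiv_finslerSpray (h : IsInvariantFrame g P B c z₀) (symm : ∀ v w, B v w = B w v)
    (pos : ∀ v, v ≠ 0 → 0 < B v v) (hF : ∀ z v, F z v ^ 2 = g z v v) (y u : E) :
    fderiv ℝ (finslerSpray F z₀) y u = christoffel g z₀ y u := by
  obtain ⟨Γ, hΓ⟩ := h.exists_christoffel symm pos
  have hs : finslerSpray F z₀ = fun v => ((1 / 2 : ℝ) • Γ) v v := by
    ext1 v
    rw [h.finslerSpray_eq symm hF, hΓ]
    rfl
  rw [hs, fderiv_apply_self]
  simp only [add_apply, smul_apply, ContinuousLinearMap.flip_apply]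
  rw [← hΓ, ← hΓ, h.christoffel_symm symm u y, ← add_smul]
  norm_num

theorem fderiv_fderiv_finslerSpray (h : IsInvariantFrame g P B c z₀) (symm : ∀ v w, B v w = B w v)
    (pos : ∀ v, v ≠ 0 → 0 < B v v) (hF : ∀ z v, F z v ^ 2 = g z v v) (y v u : E) :
    fderiv ℝ (fderiv ℝ (finslerSpray F z₀)) y v u = christoffel g z₀ v u := by
  obtain ⟨Γ, hΓ⟩ := h.exists_christoffel symm pos
  have : fderiv ℝ (finslerSpray F z₀) = Γ := by
    ext v u
    rw [h.fderiv_finslerSpray symm pos hF, hΓ]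
  rw [this, ContinuousLinearMap.fderiv, hΓ]

/-- The spray is `½ Γ(y, y)`, with first derivative `Γ(y, ·)` and second derivative `Γ` in the
direction variable. The four terms become `∂_u Γ(y,y) - ∂_y Γ(u,y) + Γ(u, Γ(y,y)) - Γ(y, Γ(u,y))`.
-/
theorem finslerRiemann_eq (h : IsInvariantFrame g P B c z₀) (symm : ∀ v w, B v w = B w v)
    (pos : ∀ v, v ≠ 0 → 0 < B v v) (hF : ∀ z v, F z v ^ 2 = g z v v) (y u : E) :
    finslerRiemann F z₀ y u = riemannTensor g z₀ u y y := by
  obtain ⟨Γ, hΓ⟩ := h.exists_christoffel symm pos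
  have e1 : fderiv ℝ (fun z => finslerSpray F z y) z₀
      = (1 / 2 : ℝ) • fderiv ℝ (fun z => christoffel g z y y) z₀ := by
    have : (fun z => finslerSpray F z y) =ᶠ[𝓝 z₀]
        (1 / 2 : ℝ) • fun z => christoffel g z y y :=
      h.eventually.mono fun z hz => hz.finslerSpray_eq symm hF y
    rw [this.fderiv_eq, fderiv_const_smul_field, Pi.smul_apply]
  have e2 : fderiv ℝ (fun z => fderiv ℝ (finslerSpray F z) y u) z₀
      = fderiv ℝ (fun z => christoffel g z u y) z₀ :=
    Filter.EventuallyEq.fderiv_eq (h.eventually.mono fun z hz => by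
      beta_reduce
      rw [hz.fderiv_finslerSpray symm pos hF, hz.christoffel_symm symm])
  rw [finslerRiemann, e1, e2, h.fderiv_fderiv_finslerSpray symm pos hF,
    h.fderiv_finslerSpray symm pos hF, h.fderiv_finslerSpray symm pos hF,
    h.finslerSpray_eq symm hF, riemannTensor, h.christoffel_symm symm u (christoffel g z₀ y y),
    h.christoffel_symm symm u y]
  simp only [smul_apply, hΓ, map_smul, smul_smul]
  norm_num

/-- The flag curvature of a Riemannian metric is its sectional curvature. -/
theorem coordFlagCurvature_eq (h : IsInvariantFrame g P B c z₀) (symm : ∀ v w, B v w = B w v)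
    (pos : ∀ v, v ≠ 0 → 0 < B v v) (anti : ∀ U V, c U V = -c V U)
    (hF : ∀ z v, F z v ^ 2 = g z v v) (y u : E) :
    coordFlagCurvature F z₀ y u = coordSectionalCurvature g z₀ y u := by
  obtain ⟨Y, rfl⟩ : ∃ Y, P z₀ Y = y := ⟨_, h.isInvertible.self_apply_inverse y⟩
  obtain ⟨U, rfl⟩ : ∃ U, P z₀ U = u := ⟨_, h.isInvertible.self_apply_inverse u⟩
  rw [coordFlagCurvature, coordSectionalCurvature, h.finslerTensor_eq symm hF,
    h.finslerRiemann_eq symm pos hF, h.riemannTensor_eq symm pos, h.riemannTensor_eq symm pos]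
  simp only [h.metric.self_of_nhds]
  -- Flag curvature has numerator `⟨R(u,y)y, u⟩`, sectional curvature `⟨R(y,u)u, y⟩`; skewness in
  -- each pair of arguments identifies them.
  rw [koszulCurvature_swap anti, map_neg, neg_apply, koszulCurvature_skew symm pos anti, neg_neg]

end IsInvariantFrame

end CoordinateCurvature

/-! ### Left-invariant vector fields in charts -/

section LieGroupCharts

variable {E : Type*} [NormedAddCommGroup E] [NormedSpace ℝ E]
  {G : Type*} [TopologicalSpace G] [ChartedSpace E G]

section Manifold

theorem mfderiv_comp_apply_of_map_eq {f : E → G} {h : E → E} {y z : E} (hz : h y = z)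
    (hf : MDifferentiableAt 𝓘(ℝ, E) 𝓘(ℝ, E) f z) (hh : DifferentiableAt ℝ h y) (U : E) :
    (mfderiv 𝓘(ℝ, E) 𝓘(ℝ, E) (f ∘ h) y : E →L[ℝ] E) U
      = (mfderiv 𝓘(ℝ, E) 𝓘(ℝ, E) f z : E →L[ℝ] E) (fderiv ℝ h y U) := by
  subst hz
  rw [mfderiv_comp y hf hh.mdifferentiableAt, mfderiv_eq_fderiv]
  rfl

variable [IsManifold 𝓘(ℝ, E) ∞ G] {E' : Type*} [NormedAddCommGroup E'] [NormedSpace ℝ E']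

theorem contMDiffAt_extChartAt_symm' (x : G) {z : E} (hz : z ∈ (extChartAt 𝓘(ℝ, E) x).target) :
    ContMDiffAt 𝓘(ℝ, E) 𝓘(ℝ, E) ∞ (extChartAt 𝓘(ℝ, E) x).symm z :=
  (contMDiffOn_extChartAt_symm x).contMDiffAt ((isOpen_extChartAt_target x).mem_nhds hz)

theorem ContMDiffAt.contDiffAt_extChartAt_comp {f : E' → G} {p : E'} (x : G)
    (hf : ContMDiffAt 𝓘(ℝ, E') 𝓘(ℝ, E) ∞ f p) (hp : f p ∈ (extChartAt 𝓘(ℝ, E) x).source) :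
    ContDiffAt ℝ ∞ (fun y => extChartAt 𝓘(ℝ, E) x (f y)) p := by
  rw [← contMDiffAt_iff_contDiffAt]
  exact (contMDiffAt_extChartAt' (by rwa [extChartAt_source] at hp)).comp p hf

/-- A Riemannian metric in the preferred chart at `x`. -/
noncomputable def coordMetric (g : RiemMetric E G) (x : G) (z : E) : E →L[ℝ] E →L[ℝ] ℝ :=
  letI b : E →L[ℝ] E →L[ℝ] ℝ := g.inner ((extChartAt 𝓘(ℝ, E) x).symm z)
  letI L : E →L[ℝ] E := chartSymmDeriv x z
  b.bilinearComp L L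

theorem coordMetric_symm (g : RiemMetric E G) (x : G) (z v w : E) :
    coordMetric g x z v w = coordMetric g x z w v :=
  g.symm ((extChartAt 𝓘(ℝ, E) x).symm z) (chartSymmDeriv x z v) (chartSymmDeriv x z w)

theorem chartVec_bijective (x : G) : Function.Bijective (chartVec (E := E) x) := by
  obtain ⟨e, he⟩ := isInvertible_mfderiv_extChartAt (I := 𝓘(ℝ, E)) (mem_extChartAt_source x)
  have : chartVec (E := E) x = e := by
    ext v
    exact congrArg (fun L : E →L[ℝ] E => L v) he.symm
  rw [this]
  exact e.bijective

theorem chartSymmDeriv_injective (x : G) {z : E} (hz : z ∈ (extChartAt 𝓘(ℝ, E) x).target) :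
    Function.Injective (chartSymmDeriv x z) := by
  have h := mfderiv_extChartAt_comp_mfderivWithin_extChartAt_symm (I := 𝓘(ℝ, E)) (x := x) hz
  rw [ModelWithCorners.range_eq_univ, mfderivWithin_univ] at h
  intro v w hvw
  have hv := congrArg (fun L : E →L[ℝ] E => L v) h
  have hw := congrArg (fun L : E →L[ℝ] E => L w) h
  exact hv.symm.trans ((congrArg _ hvw).trans hw)

theorem coordMetric_pos (g : RiemMetric E G) (x : G) {z : E}
    (hz : z ∈ (extChartAt 𝓘(ℝ, E) x).target) (v : E) (hv : v ≠ 0) : 0 < coordMetric g x z v v := by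
  exact g.pos _ _ fun h => hv (chartSymmDeriv_injective x hz
    (h.trans (map_zero (chartSymmDeriv x z)).symm))

theorem RiemMetric.inner_congr (g : RiemMetric E G) {p q : G} (h : p = q) (v w : E) :
    g.inner p v w = g.inner q v w := by
  subst h
  rfl

end Manifold

variable [Group G]

/-- Right multiplication by an element near `1`, in the preferred charts at `x` and at `1`. -/
noncomputable def mulChart (x : G) (z y : E) : E :=
  extChartAt 𝓘(ℝ, E) x ((extChartAt 𝓘(ℝ, E) x).symm z * (extChartAt 𝓘(ℝ, E) (1 : G)).symm y)

variable (E G) in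
/-- The identity in the preferred chart. -/
noncomputable def chartOne : E := extChartAt 𝓘(ℝ, E) (1 : G) 1

variable (E G) in
theorem chartOne_symm : (extChartAt 𝓘(ℝ, E) (1 : G)).symm (chartOne E G) = 1 :=
  extChartAt_to_inv (1 : G)

variable (E G) in
theorem chartOne_mem : chartOne E G ∈ (extChartAt 𝓘(ℝ, E) (1 : G)).target :=
  mem_extChartAt_target (1 : G)

/-- The frame of left-invariant vector fields, in the preferred chart at `x`. -/
noncomputable def leftFrame (x : G) (z : E) : E →L[ℝ] E :=
  fderiv ℝ (mulChart x z) (chartOne E G)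

variable (E G) in
/-- The Lie bracket of the Lie algebra, in the preferred chart at `1`. -/
noncomputable def chartBracket : E →L[ℝ] E →L[ℝ] E :=
  fderiv ℝ (leftFrame (1 : G)) (chartOne E G) - (fderiv ℝ (leftFrame (1 : G)) (chartOne E G)).flip

theorem chartBracket_anti (U V : E) : chartBracket E G U V = -chartBracket E G V U := by
  simp [chartBracket]

variable {x : G} {z : E}

theorem mulChart_chartOne (hz : z ∈ (extChartAt 𝓘(ℝ, E) x).target) :
    mulChart x z (chartOne E G) = z := by
  rw [mulChart, chartOne_symm, mul_one, PartialEquiv.right_inv _ hz]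

theorem leftFrame_one : leftFrame (1 : G) (chartOne E G) = .id ℝ E := by
  have : mulChart (1 : G) (chartOne E G) =ᶠ[𝓝 (chartOne E G)] id := by
    filter_upwards [(isOpen_extChartAt_target (I := 𝓘(ℝ, E)) (1 : G)).mem_nhds (chartOne_mem E G)]
      with y hy
    rw [mulChart, chartOne_symm, one_mul, PartialEquiv.right_inv _ hy, id]
  rw [leftFrame, this.fderiv_eq, fderiv_id]

variable [LieGroup 𝓘(ℝ, E) ∞ G]

theorem eventually_mem_source_mul (a b : G) {U : Set G} (hU : IsOpen U) (h : a * b ∈ U) :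
    ∀ᶠ y in 𝓝 (chartOne E G), a * (extChartAt 𝓘(ℝ, E) (1 : G)).symm y * b ∈ U := by
  have := topologicalGroup_of_lieGroup 𝓘(ℝ, E) ∞ (G := G)
  have hc : ContinuousAt (fun y => a * (extChartAt 𝓘(ℝ, E) (1 : G)).symm y * b) (chartOne E G) :=
    (continuousAt_const.mul (continuousAt_extChartAt_symm (I := 𝓘(ℝ, E)) (1 : G))).mul
      continuousAt_const
  exact hc (hU.mem_nhds (by beta_reduce; rwa [chartOne_symm, mul_one]))

theorem contDiffAt_mulChart (hz : z ∈ (extChartAt 𝓘(ℝ, E) x).target) :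
    ContDiffAt ℝ ∞ (fun p : E × E => mulChart x p.1 p.2) (z, chartOne E G) := by
  refine ContMDiffAt.contDiffAt_extChartAt_comp x (ContMDiffAt.mul
    ((contMDiffAt_extChartAt_symm' x hz).comp (z, chartOne E G) contDiffAt_fst.contMDiffAt)
    ((contMDiffAt_extChartAt_symm' 1 (chartOne_mem E G)).comp (z, chartOne E G)
      contDiffAt_snd.contMDiffAt)) ?_
  simp only [chartOne_symm, mul_one]
  exact PartialEquiv.map_target _ hz

theorem contDiffAt_mulChart_right (hz : z ∈ (extChartAt 𝓘(ℝ, E) x).target) :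
    ContDiffAt ℝ ∞ (mulChart x z) (chartOne E G) :=
  (contDiffAt_mulChart hz).comp (chartOne E G) (contDiffAt_const.prodMk contDiffAt_id)

theorem contDiffAt_leftFrame (hz : z ∈ (extChartAt 𝓘(ℝ, E) x).target) :
    ContDiffAt ℝ ∞ (leftFrame x) z :=
  ContDiffAt.fderiv (f := mulChart x) (n := ∞) (contDiffAt_mulChart hz) contDiffAt_const le_rfl

theorem mulChart_assoc (hz : z ∈ (extChartAt 𝓘(ℝ, E) x).target) :
    ∀ᶠ b in 𝓝 (chartOne E G), ∀ᶠ y in 𝓝 (chartOne E G),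
      mulChart x z (mulChart (1 : G) b y) = mulChart x (mulChart x z b) y := by
  filter_upwards [eventually_mem_source_mul (E := E) ((extChartAt 𝓘(ℝ, E) x).symm z) 1
      (isOpen_extChartAt_source (I := 𝓘(ℝ, E)) x) (by rw [mul_one]; exact PartialEquiv.map_target _ hz),
    (isOpen_extChartAt_target (I := 𝓘(ℝ, E)) (1 : G)).mem_nhds (chartOne_mem E G)] with b h1 h2
  filter_upwards [eventually_mem_source_mul (E := E) ((extChartAt 𝓘(ℝ, E) (1 : G)).symm b) 1
    (isOpen_extChartAt_source (I := 𝓘(ℝ, E)) (1 : G))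
    (by rw [mul_one]; exact PartialEquiv.map_target _ h2)] with y h3
  rw [mul_one] at h1 h3
  simp only [mulChart]
  rw [PartialEquiv.left_inv _ h1, PartialEquiv.left_inv _ h3, mul_assoc]

/-- Left-invariance of the frame: differentiate `z (b y) = (z b) y` in `y` at the identity. -/
theorem fderiv_mulChart_comp_leftFrame (hz : z ∈ (extChartAt 𝓘(ℝ, E) x).target) :
    ∀ᶠ b in 𝓝 (chartOne E G),
      (fderiv ℝ (mulChart x z) b).comp (leftFrame (1 : G) b) = leftFrame x (mulChart x z b) := by
  have hd : ∀ᶠ b in 𝓝 (chartOne E G), DifferentiableAt ℝ (mulChart x z) b :=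
    (((contDiffAt_mulChart_right hz).of_le (m := 1) (by simp)).eventually (by simp)).mono
      fun b hb => hb.differentiableAt (by simp)
  filter_upwards [mulChart_assoc hz, hd,
    (isOpen_extChartAt_target (I := 𝓘(ℝ, E)) (1 : G)).mem_nhds (chartOne_mem E G)] with b h1 h2 h3
  rw [leftFrame, leftFrame, ← Filter.EventuallyEq.fderiv_eq h1]
  rw [← mulChart_chartOne h3] at h2
  have := fderiv_comp (chartOne E G) h2
    ((contDiffAt_mulChart_right h3).differentiableAt (by simp))
  rw [mulChart_chartOne h3] at this
  exact this.symm

/-- Differentiating the left-invariance identity in `b` at the identity gives the second derivative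
of left multiplication plus the image of the derivative of the frame at `1`. Antisymmetrising
removes the former. -/
theorem leftFrame_bracket (hz : z ∈ (extChartAt 𝓘(ℝ, E) x).target) (U V : E) :
    fderiv ℝ (leftFrame x) z (leftFrame x z U) V - fderiv ℝ (leftFrame x) z (leftFrame x z V) U
      = leftFrame x z (chartBracket E G U V) := by
  have hm := contDiffAt_mulChart_right hz
  have key : ∀ U V, fderiv ℝ (leftFrame x) z (leftFrame x z U) V
      = fderiv ℝ (fderiv ℝ (mulChart x z)) (chartOne E G) U V
        + leftFrame x z (fderiv ℝ (leftFrame (1 : G)) (chartOne E G) U V) := by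
    intro U V
    have h1 : HasFDerivAt (fderiv ℝ (mulChart x z)) _ (chartOne E G) :=
      ((hm.fderiv_right (m := ∞) le_rfl).differentiableAt (by simp)).hasFDerivAt
    have h2 : HasFDerivAt (leftFrame (1 : G)) _ (chartOne E G) :=
      ((contDiffAt_leftFrame (chartOne_mem E G)).differentiableAt (by simp)).hasFDerivAt
    have h3 : HasFDerivAt (leftFrame x) (fderiv ℝ (leftFrame x) z)
        (mulChart x z (chartOne E G)) := by
      rw [mulChart_chartOne hz]
      exact ((contDiffAt_leftFrame hz).differentiableAt (by simp)).hasFDerivAt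
    have h4 : HasFDerivAt (mulChart x z) (leftFrame x z) (chartOne E G) :=
      (hm.differentiableAt (by simp)).hasFDerivAt
    have h5 := (h3.comp _ h4).congr_of_eventuallyEq (fderiv_mulChart_comp_leftFrame hz)
    have h6 := congrArg (fun f => f U V) (h5.unique (h1.clm_comp h2))
    refine h6.trans ?_
    simp only [add_apply, ContinuousLinearMap.comp_apply, ContinuousLinearMap.compL_apply,
      ContinuousLinearMap.flip_apply, leftFrame_one, ContinuousLinearMap.comp_id]
    exact add_comm _ _
  rw [key, key, (hm.of_le (m := 2) ENat.LEInfty.out).isSymmSndFDerivAt (by simp) U V, chartBracket]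
  simp

/-- Left multiplication by the inverse element, read in charts, provides a left inverse of the
differential. -/
theorem leftFrame_injective (hz : z ∈ (extChartAt 𝓘(ℝ, E) x).target) :
    Function.Injective (leftFrame x z) := by
  let a := (extChartAt 𝓘(ℝ, E) x).symm z
  let l : E → E := fun y => extChartAt 𝓘(ℝ, E) (1 : G) (a⁻¹ * (extChartAt 𝓘(ℝ, E) x).symm y)
  have hl : ContDiffAt ℝ ∞ l (mulChart x z (chartOne E G)) := by
    rw [mulChart_chartOne hz]
    refine ContMDiffAt.contDiffAt_extChartAt_comp 1 (ContMDiffAt.mul contMDiffAt_const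
      (contMDiffAt_extChartAt_symm' x hz)) ?_
    simp [a]
  have h1 := (hl.differentiableAt (by simp)).hasFDerivAt.comp (chartOne E G)
    ((contDiffAt_mulChart_right hz).differentiableAt (by simp)).hasFDerivAt
  have h2 : HasFDerivAt (l ∘ mulChart x z) (.id ℝ E) (chartOne E G) := by
    refine (hasFDerivAt_id _).congr_of_eventuallyEq ?_
    filter_upwards [eventually_mem_source_mul (E := E) a 1
      (isOpen_extChartAt_source (I := 𝓘(ℝ, E)) x) (by rw [mul_one]; exact PartialEquiv.map_target _ hz),
      (isOpen_extChartAt_target (I := 𝓘(ℝ, E)) (1 : G)).mem_nhds (chartOne_mem E G)] with y h1 h2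
    rw [mul_one] at h1
    simp only [Function.comp_apply, l, mulChart]
    rw [PartialEquiv.left_inv _ h1, inv_mul_cancel_left, PartialEquiv.right_inv _ h2, id]
  have h3 := h1.unique h2
  intro v w hvw
  have hv := congrArg (fun L : E →L[ℝ] E => L v) h3
  have hw := congrArg (fun L : E →L[ℝ] E => L w) h3
  exact hv.symm.trans ((congrArg _ hvw).trans hw)

theorem coordMetric_leftFrame {g : RiemMetric E G} (hg : g.IsInvariant G)
    (hz : z ∈ (extChartAt 𝓘(ℝ, E) x).target) (U V : E) :
    coordMetric g x z (leftFrame x z U) (leftFrame x z V)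
      = coordMetric g 1 (chartOne E G) U V := by
  let a := (extChartAt 𝓘(ℝ, E) x).symm z
  let p := (extChartAt 𝓘(ℝ, E) (1 : G)).symm (chartOne E G)
  -- `mulChart x z` is left multiplication by `a` read in charts, so the frame at `z` is the image
  -- under its differential of the frame at `1`, and invariance of `g` applies.
  have hev : (extChartAt 𝓘(ℝ, E) x).symm ∘ mulChart x z =ᶠ[𝓝 (chartOne E G)]
      (fun b : G => a • b) ∘ (extChartAt 𝓘(ℝ, E) (1 : G)).symm := by
    filter_upwards [eventually_mem_source_mul (E := E) a 1
      (isOpen_extChartAt_source (I := 𝓘(ℝ, E)) x) (by rw [mul_one]; exact PartialEquiv.map_target _ hz)]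
      with y h1
    rw [mul_one] at h1
    simp only [Function.comp_apply, mulChart, smul_eq_mul]
    rw [PartialEquiv.left_inv _ h1]
  have hm : MDifferentiableAt 𝓘(ℝ, E) 𝓘(ℝ, E) (fun b : G => a • b) p :=
    (contMDiff_mul_left (I := 𝓘(ℝ, E)) (n := ∞) (a := a)).contMDiffAt.mdifferentiableAt (by simp)
  have key : ∀ U, (chartSymmDeriv x z : E →L[ℝ] E) (leftFrame x z U)
      = (mfderiv 𝓘(ℝ, E) 𝓘(ℝ, E) (fun b : G => a • b) p : E →L[ℝ] E)
        (chartSymmDeriv (1 : G) (chartOne E G) U) := by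
    intro U
    have h1 := mfderiv_comp_apply_of_map_eq (mulChart_chartOne hz)
      ((contMDiffAt_extChartAt_symm' x hz).mdifferentiableAt (by simp))
      ((contDiffAt_mulChart_right hz).differentiableAt (by simp)) U
    have h2 := mfderiv_comp (I := 𝓘(ℝ, E)) (I' := 𝓘(ℝ, E)) (I'' := 𝓘(ℝ, E)) (chartOne E G) hm
      ((contMDiffAt_extChartAt_symm' (1 : G) (chartOne_mem E G)).mdifferentiableAt (by simp))
    refine h1.symm.trans ?_
    have h3 := hev.mfderiv_eq (I := 𝓘(ℝ, E)) (I' := 𝓘(ℝ, E))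
    exact congrArg (fun L : E →L[ℝ] E => L U) (h3.trans h2)
  have hp : a = a • p := by simp [p, chartOne_symm]
  refine Eq.trans ?_ (hg a p (chartSymmDeriv (1 : G) (chartOne E G) U)
    (chartSymmDeriv (1 : G) (chartOne E G) V))
  refine Eq.trans ?_ (g.inner_congr hp _ _)
  exact congrArg₂ (fun v w : E => g.inner a v w) (key U) (key V)

/-- The left-invariant vector fields are an invariant frame for a left-invariant metric. -/
theorem isInvariantFrame_leftFrame [FiniteDimensional ℝ E] {g : RiemMetric E G}
    (hg : g.IsInvariant G) (hz : z ∈ (extChartAt 𝓘(ℝ, E) x).target) :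
    IsInvariantFrame (coordMetric g x) (leftFrame x) (coordMetric g 1 (chartOne E G))
      (chartBracket E G) z where
  contDiff := (contDiffAt_leftFrame hz).of_le ENat.LEInfty.out
  isInvertible := ContinuousLinearMap.isInvertible_of_injective (leftFrame_injective hz)
  metric := by
    filter_upwards [(isOpen_extChartAt_target (I := 𝓘(ℝ, E)) x).mem_nhds hz] with y hy U V
    exact coordMetric_leftFrame hg hy U V
  bracket := by
    filter_upwards [(isOpen_extChartAt_target (I := 𝓘(ℝ, E)) x).mem_nhds hz] with y hy U V
    exact leftFrame_bracket hy U V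

end LieGroupCharts

/-! ### The adjoint representation, commutators and nilpotency -/

section AdjointRepresentation

variable {E : Type*} [NormedAddCommGroup E] [NormedSpace ℝ E]
  {G : Type*} [TopologicalSpace G] [ChartedSpace E G] [Group G]

/-- Conjugation in the preferred chart at `1`. -/
noncomputable def conjChart (a : G) (y : E) : E :=
  extChartAt 𝓘(ℝ, E) (1 : G) (a * (extChartAt 𝓘(ℝ, E) (1 : G)).symm y * a⁻¹)

variable (E) in
/-- The adjoint representation in the preferred chart at `1`. -/
noncomputable def chartAd (a : G) : E →L[ℝ] E :=
  fderiv ℝ (conjChart a) (chartOne E G)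

/-- The commutator `b ↦ b⁻¹ * a * b * a⁻¹` in the preferred chart at `1`. -/
noncomputable def commChart (a : G) (y : E) : E :=
  extChartAt 𝓘(ℝ, E) (1 : G) (((extChartAt 𝓘(ℝ, E) (1 : G)).symm y)⁻¹ *
    (a * (extChartAt 𝓘(ℝ, E) (1 : G)).symm y * a⁻¹))

theorem conjChart_chartOne (a : G) : conjChart a (chartOne E G) = chartOne E G := by
  rw [conjChart, chartOne_symm, mul_one, mul_inv_cancel]
  rfl

theorem commChart_chartOne (a : G) : commChart a (chartOne E G) = chartOne E G := by
  rw [commChart, chartOne_symm, mul_one, mul_inv_cancel, inv_one, one_mul]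
  rfl

theorem Subgroup.eq_top_of_mem_nhds_one [IsTopologicalGroup G] [ConnectedSpace G] (S : Subgroup G)
    (h : (S : Set G) ∈ 𝓝 1) : S = ⊤ := by
  have ho : IsOpen (S : Set G) := S.isOpen_of_mem_nhds h
  have hc : IsClosed (S : Set G) := S.isClosed_of_isOpen ho
  rw [← SetLike.coe_set_eq, Subgroup.coe_top]
  exact IsClopen.eq_univ ⟨hc, ho⟩ ⟨1, S.one_mem⟩

theorem eventually_mem_target :
    ∀ᶠ y in 𝓝 (chartOne E G), y ∈ (extChartAt 𝓘(ℝ, E) (1 : G)).target :=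
  (isOpen_extChartAt_target (I := 𝓘(ℝ, E)) (1 : G)).mem_nhds (chartOne_mem E G)

/-- The frame of right-invariant vector fields, in the preferred chart at `1`. -/
noncomputable def rightFrame (G : Type*) [TopologicalSpace G] [ChartedSpace E G] [Group G] (z : E) :
    E →L[ℝ] E :=
  fderiv ℝ (fun y => mulChart (1 : G) y z) (chartOne E G)

theorem rightFrame_chartOne : rightFrame G (chartOne E G) = .id ℝ E := by
  have : (fun y => mulChart (1 : G) y (chartOne E G)) =ᶠ[𝓝 (chartOne E G)] id := by
    filter_upwards [eventually_mem_target (E := E) (G := G)] with y hy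
    exact mulChart_chartOne hy
  rw [rightFrame, this.fderiv_eq, fderiv_id]

variable [LieGroup 𝓘(ℝ, E) ∞ G]

theorem contMDiffAt_chartOne_symm :
    ContMDiffAt 𝓘(ℝ, E) 𝓘(ℝ, E) ∞ (extChartAt 𝓘(ℝ, E) (1 : G)).symm (chartOne E G) :=
  contMDiffAt_extChartAt_symm' 1 (chartOne_mem E G)

theorem contDiffAt_conjChart (a : G) : ContDiffAt ℝ ∞ (conjChart a) (chartOne E G) := by
  refine ContMDiffAt.contDiffAt_extChartAt_comp 1 (ContMDiffAt.mul
    (ContMDiffAt.mul contMDiffAt_const contMDiffAt_chartOne_symm) contMDiffAt_const) ?_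
  rw [chartOne_symm, mul_one, mul_inv_cancel]
  exact mem_extChartAt_source _

theorem contDiffAt_commChart (a : G) : ContDiffAt ℝ ∞ (commChart a) (chartOne E G) := by
  refine ContMDiffAt.contDiffAt_extChartAt_comp 1 (ContMDiffAt.mul
    (ContMDiffAt.inv contMDiffAt_chartOne_symm) (ContMDiffAt.mul
    (ContMDiffAt.mul contMDiffAt_const contMDiffAt_chartOne_symm) contMDiffAt_const)) ?_
  rw [chartOne_symm, mul_one, mul_inv_cancel, inv_one, one_mul]
  exact mem_extChartAt_source _

theorem hasFDerivAt_conjChart (a : G) :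
    HasFDerivAt (conjChart a) (chartAd E a) (chartOne E G) :=
  ((contDiffAt_conjChart a).differentiableAt (by simp)).hasFDerivAt

theorem eventually_conj_mem_source (a : G) : ∀ᶠ y in 𝓝 (chartOne E G),
    a * (extChartAt 𝓘(ℝ, E) (1 : G)).symm y * a⁻¹ ∈ (extChartAt 𝓘(ℝ, E) (1 : G)).source :=
  eventually_mem_source_mul a a⁻¹ (isOpen_extChartAt_source (1 : G))
    (by rw [mul_inv_cancel]; exact mem_extChartAt_source _)

theorem chartAd_mul (a b : G) : chartAd E (a * b) = (chartAd E a).comp (chartAd E b) := by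
  have ha := hasFDerivAt_conjChart (E := E) a
  rw [← conjChart_chartOne b] at ha
  refine (hasFDerivAt_conjChart (a * b)).unique
    ((ha.comp _ (hasFDerivAt_conjChart b)).congr_of_eventuallyEq ?_)
  filter_upwards [eventually_conj_mem_source (E := E) b] with y hy
  simp only [Function.comp_apply, conjChart]
  rw [PartialEquiv.left_inv _ hy, mul_inv_rev]
  simp only [mul_assoc]

theorem chartAd_one : chartAd E (1 : G) = .id ℝ E := by
  refine (hasFDerivAt_conjChart (1 : G)).unique ((hasFDerivAt_id _).congr_of_eventuallyEq ?_)
  filter_upwards [eventually_mem_target (E := E) (G := G)] with y hy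
  rw [conjChart, inv_one, one_mul, mul_one, PartialEquiv.right_inv _ hy, id]

theorem contDiffAt_mulChart_one :
    ContDiffAt ℝ ∞ (fun p : E × E => mulChart (1 : G) p.1 p.2) (chartOne E G, chartOne E G) :=
  contDiffAt_mulChart (chartOne_mem E G)

theorem contDiffAt_rightFrame : ContDiffAt ℝ ∞ (rightFrame (E := E) G) (chartOne E G) :=
  ContDiffAt.fderiv (f := fun z y => mulChart (1 : G) y z) (n := ∞)
    (ContDiffAt.comp (g := fun p : E × E => mulChart (1 : G) p.1 p.2) (f := Prod.swap)
      (chartOne E G, chartOne E G) contDiffAt_mulChart_one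
      (contDiffAt_snd.prodMk contDiffAt_fst)) contDiffAt_const le_rfl

theorem eventually_differentiableAt_mulChart : ∀ᶠ p in 𝓝 (chartOne E G, chartOne E G),
    DifferentiableAt ℝ (fun p : E × E => mulChart (1 : G) p.1 p.2) p :=
  ((contDiffAt_mulChart_one.of_le (m := 1) (by simp)).eventually (by simp)).mono
    fun _ h => h.differentiableAt (by simp)

/-- Both sides are the mixed second derivative of the product at `(1, 1)`. -/
theorem fderiv_rightFrame (V W : E) : fderiv ℝ (rightFrame G) (chartOne E G) V W
    = fderiv ℝ (leftFrame (1 : G)) (chartOne E G) W V := by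
  let m := fun p : E × E => mulChart (1 : G) p.1 p.2
  let e := chartOne E G
  have hm := eventually_differentiableAt_mulChart (E := E) (G := G)
  have h2 : HasFDerivAt (fderiv ℝ m) (fderiv ℝ (fderiv ℝ m) (e, e)) (e, e) :=
    ((contDiffAt_mulChart_one.fderiv_right (m := ∞) le_rfl).differentiableAt
      (by simp)).hasFDerivAt
  have hl : HasFDerivAt (fun z : E => (z, e)) (.inl ℝ E E) e := hasFDerivAt_prodMk_left e e
  have hr : HasFDerivAt (fun z : E => (e, z)) (.inr ℝ E E) e := hasFDerivAt_prodMk_right e e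
  have h3 : leftFrame (1 : G) =ᶠ[𝓝 e] fun z => (fderiv ℝ m (z, e)).comp (.inr ℝ E E) := by
    filter_upwards [hl.continuousAt.tendsto.eventually hm] with z hz
    exact (HasFDerivAt.comp (g := m) (f := fun y => (z, y)) e hz.hasFDerivAt
      (hasFDerivAt_prodMk_right z e)).fderiv
  have h4 : rightFrame G =ᶠ[𝓝 e] fun z => (fderiv ℝ m (e, z)).comp (.inl ℝ E E) := by
    filter_upwards [hr.continuousAt.tendsto.eventually hm] with z hz
    exact (HasFDerivAt.comp (g := m) (f := fun y => (y, z)) e hz.hasFDerivAt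
      (hasFDerivAt_prodMk_left e z)).fderiv
  have h5 := ((HasFDerivAt.comp (f := fun z => (z, e)) e h2 hl).clm_comp
    (hasFDerivAt_const (.inr ℝ E E : E →L[ℝ] E × E) e)).congr_of_eventuallyEq h3
  have h6 := ((HasFDerivAt.comp (f := fun z => (e, z)) e h2 hr).clm_comp
    (hasFDerivAt_const (.inl ℝ E E : E →L[ℝ] E × E) e)).congr_of_eventuallyEq h4
  rw [h5.fderiv, h6.fderiv]
  have hs := (contDiffAt_mulChart_one (E := E) (G := G)).isSymmSndFDerivAt
    (by simpa using ENat.LEInfty.out) (0, V) (W, 0)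
  simpa using hs

/-- Differentiate `(z y z⁻¹) z = z y` in `y` at the identity. -/
theorem eventually_rightFrame_comp_chartAd : ∀ᶠ z in 𝓝 (chartOne E G),
    (rightFrame G z).comp (chartAd E ((extChartAt 𝓘(ℝ, E) (1 : G)).symm z))
      = leftFrame (1 : G) z := by
  have hr : ContinuousAt (fun z : E => (chartOne E G, z)) (chartOne E G) := by fun_prop
  filter_upwards [hr.tendsto.eventually (eventually_differentiableAt_mulChart (E := E) (G := G)),
    eventually_mem_target (E := E) (G := G)] with z hz ht
  have h1 : HasFDerivAt (fun y => mulChart (1 : G) y z) (rightFrame G z) (chartOne E G) :=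
    (DifferentiableAt.comp (g := fun p : E × E => mulChart (1 : G) p.1 p.2)
      (f := fun y => (y, z)) (chartOne E G) hz
      (hasFDerivAt_prodMk_left (chartOne E G) z).differentiableAt).hasFDerivAt
  let a := (extChartAt 𝓘(ℝ, E) (1 : G)).symm z
  rw [← conjChart_chartOne a] at h1
  have h2 := h1.comp _ (hasFDerivAt_conjChart a)
  refine (h2.congr_of_eventuallyEq ?_).fderiv.symm
  filter_upwards [eventually_conj_mem_source (E := E) a] with y hy
  simp only [Function.comp_apply, conjChart, mulChart]
  rw [PartialEquiv.left_inv _ hy, inv_mul_cancel_right]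

/-- The differential of the adjoint representation is the Lie bracket. -/
theorem hasFDerivAt_chartAd [FiniteDimensional ℝ E] :
    HasFDerivAt (fun z => chartAd E ((extChartAt 𝓘(ℝ, E) (1 : G)).symm z)) (chartBracket E G)
      (chartOne E G) := by
  have := FiniteDimensional.complete ℝ E
  have hQ := contDiffAt_rightFrame (E := E) (G := G)
  have hi : (rightFrame G (chartOne E G)).IsInvertible := by
    rw [rightFrame_chartOne]
    exact ⟨.refl ℝ E, rfl⟩
  -- Near the identity the right frame is invertible, so `Ad` is its inverse composed with the left
  -- frame, both smooth.
  have hd : DifferentiableAt ℝ (fun z => chartAd E ((extChartAt 𝓘(ℝ, E) (1 : G)).symm z))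
      (chartOne E G) := by
    have h1 : DifferentiableAt ℝ (fun z => (rightFrame G z).inverse.comp (leftFrame (1 : G) z))
        (chartOne E G) :=
      (((hi.contDiffAt_map_inverse (n := ∞)).comp _ hQ).differentiableAt (by simp)).clm_comp
        ((contDiffAt_leftFrame (chartOne_mem E G)).differentiableAt (by simp))
    refine h1.congr_of_eventuallyEq ?_
    filter_upwards [eventually_rightFrame_comp_chartAd (E := E) (G := G),
      hi.eventually hQ.continuousAt] with z h1 h2
    rw [← h1]
    ext v
    exact (h2.inverse_apply_self _).symm
  have h1 := (hQ.differentiableAt (by simp)).hasFDerivAt.clm_comp hd.hasFDerivAt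
  have h2 := ((contDiffAt_leftFrame (chartOne_mem E G)).differentiableAt
    (by simp)).hasFDerivAt.congr_of_eventuallyEq (eventually_rightFrame_comp_chartAd (E := E))
  refine hd.hasFDerivAt.congr_fderiv ?_
  ext V W
  have h3 := congrArg (fun L => L V W) (h1.unique h2)
  simp only [add_apply, ContinuousLinearMap.comp_apply, ContinuousLinearMap.compL_apply,
    ContinuousLinearMap.flip_apply, rightFrame_chartOne, chartOne_symm, chartAd_one,
    ContinuousLinearMap.comp_id, ContinuousLinearMap.id_comp] at h3
  rw [fderiv_rightFrame] at h3
  exact eq_sub_of_add_eq h3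

/-- A function on a Lie group with vanishing right-invariant derivatives is locally constant. -/
theorem eventually_eq_of_hasFDerivAt_zero {F : Type*} [NormedAddCommGroup F] [NormedSpace ℝ F]
    {f : G → F} (hf : ∀ᶠ a in 𝓝 (1 : G), HasFDerivAt
      (fun y => f ((extChartAt 𝓘(ℝ, E) (1 : G)).symm y * a)) (0 : E →L[ℝ] F) (chartOne E G)) :
    ∀ᶠ a in 𝓝 (1 : G), f a = f 1 := by
  have := topologicalGroup_of_lieGroup 𝓘(ℝ, E) ∞ (G := G)
  let φ := extChartAt 𝓘(ℝ, E) (1 : G)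
  have hφ : Tendsto φ.symm (𝓝 (chartOne E G)) (𝓝 1) := by
    have := (contMDiffAt_chartOne_symm (E := E) (G := G)).continuousAt.tendsto
    rwa [chartOne_symm] at this
  have hd : ∀ᶠ z in 𝓝 (chartOne E G), HasFDerivAt (f ∘ φ.symm) (0 : E →L[ℝ] F) z := by
    filter_upwards [hφ.eventually hf, eventually_mem_target (E := E) (G := G)] with z h1 h2
    -- Near `z`, `f ∘ φ.symm` is the function of the hypothesis with `a = φ.symm z`, composed with
    -- this right translation taking `z` to the identity.
    let l : E → E := fun y => φ (φ.symm y * (φ.symm z)⁻¹)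
    have hc := contMDiffAt_extChartAt_symm' (1 : G) h2
    have hl : ContDiffAt ℝ ∞ l z := by
      refine ContMDiffAt.contDiffAt_extChartAt_comp 1 (ContMDiffAt.mul hc contMDiffAt_const) ?_
      rw [mul_inv_cancel]
      exact mem_extChartAt_source _
    have hlz : chartOne E G = l z := by
      simp only [l]
      rw [mul_inv_cancel]
      rfl
    rw [hlz] at h1
    have h3 := h1.comp z (hl.differentiableAt (by simp)).hasFDerivAt
    rw [ContinuousLinearMap.zero_comp] at h3
    refine h3.congr_of_eventuallyEq ?_
    have h4 : ∀ᶠ y in 𝓝 z, φ.symm y * (φ.symm z)⁻¹ ∈ φ.source := by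
      have : ContinuousAt (fun y => φ.symm y * (φ.symm z)⁻¹) z :=
        hc.continuousAt.mul continuousAt_const
      refine this ((isOpen_extChartAt_source (I := 𝓘(ℝ, E)) (1 : G)).mem_nhds ?_)
      beta_reduce
      rw [mul_inv_cancel]
      exact mem_extChartAt_source _
    filter_upwards [h4] with y hy
    simp only [Function.comp_apply, l]
    rw [PartialEquiv.left_inv _ hy, inv_mul_cancel_right]
  obtain ⟨r, hr, hball⟩ := Metric.eventually_nhds_iff_ball.1 hd
  have hconst : ∀ z ∈ Metric.ball (chartOne E G) r, f (φ.symm z) = f 1 := by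
    intro z hz
    have := (convex_ball (chartOne E G) r).is_const_of_fderivWithin_eq_zero (𝕜 := ℝ)
      (f := f ∘ φ.symm) (fun y hy => (hball y hy).differentiableAt.differentiableWithinAt)
      (fun y hy => by
        rw [fderivWithin_of_isOpen Metric.isOpen_ball hy, (hball y hy).fderiv])
      hz (Metric.mem_ball_self hr)
    exact this.trans (congrArg f (chartOne_symm E G))
  have hφ1 : ContinuousAt φ 1 := continuousAt_extChartAt (I := 𝓘(ℝ, E)) (1 : G)
  filter_upwards [hφ1 (Metric.ball_mem_nhds _ hr), extChartAt_source_mem_nhds (I := 𝓘(ℝ, E)) (1 : G)]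
    with a h1 h2
  rw [← hconst _ h1, PartialEquiv.left_inv _ h2]

/-- Differentiate `b (b⁻¹ a b a⁻¹) = a b a⁻¹` at `b = 1`, where the differential of the product is
addition. -/
theorem hasFDerivAt_commChart (a : G) :
    HasFDerivAt (commChart a) (chartAd E a - .id ℝ E) (chartOne E G) := by
  have hk := ((contDiffAt_commChart (E := E) a).differentiableAt (by simp)).hasFDerivAt
  have hm := ((contDiffAt_mulChart_one (E := E) (G := G)).differentiableAt (by simp)).hasFDerivAt
  let m := fun p : E × E => mulChart (1 : G) p.1 p.2
  let e := chartOne E G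
  have h1 : ∀ v, fderiv ℝ m (e, e) (v, 0) = v := by
    intro v
    have := (HasFDerivAt.comp (g := m) (f := fun y => (y, e)) e hm
      (hasFDerivAt_prodMk_left e e)).fderiv.symm.trans (rightFrame_chartOne (E := E) (G := G))
    exact congrArg (fun L => L v) this
  have h2 : ∀ v, fderiv ℝ m (e, e) (0, v) = v := by
    intro v
    have := (HasFDerivAt.comp (g := m) (f := fun y => (e, y)) e hm
      (hasFDerivAt_prodMk_right e e)).fderiv.symm.trans (leftFrame_one (E := E) (G := G))
    exact congrArg (fun L => L v) this
  have hm' : HasFDerivAt m (fderiv ℝ m (e, e)) (e, commChart a e) := by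
    rw [commChart_chartOne]
    exact hm
  have h3 := HasFDerivAt.comp (g := m) (f := fun y => (y, commChart a y)) e hm'
    ((hasFDerivAt_id _).prodMk hk)
  have h4 : m ∘ (fun y => (y, commChart a y)) =ᶠ[𝓝 e] conjChart a := by
    have hs : ∀ᶠ y in 𝓝 e, ((extChartAt 𝓘(ℝ, E) (1 : G)).symm y)⁻¹ *
        (a * (extChartAt 𝓘(ℝ, E) (1 : G)).symm y * a⁻¹) ∈ (extChartAt 𝓘(ℝ, E) (1 : G)).source := by
      have := topologicalGroup_of_lieGroup 𝓘(ℝ, E) ∞ (G := G)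
      have hc := (contMDiffAt_chartOne_symm (E := E) (G := G)).continuousAt
      refine (hc.inv.mul ((continuousAt_const.mul hc).mul continuousAt_const))
        ((isOpen_extChartAt_source (I := 𝓘(ℝ, E)) (1 : G)).mem_nhds ?_)
      change ((extChartAt 𝓘(ℝ, E) (1 : G)).symm (chartOne E G))⁻¹ *
        (a * (extChartAt 𝓘(ℝ, E) (1 : G)).symm (chartOne E G) * a⁻¹) ∈ _
      rw [chartOne_symm, mul_one, mul_inv_cancel, inv_one, one_mul]
      exact mem_extChartAt_source _
    filter_upwards [hs] with y hy
    simp only [Function.comp_apply, m, mulChart, commChart, conjChart]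
    rw [PartialEquiv.left_inv _ hy, mul_inv_cancel_left]
  have h5 := (hasFDerivAt_conjChart (E := E) a).unique (h3.congr_of_eventuallyEq h4.symm)
  refine hk.congr_fderiv ?_
  rw [h5]
  ext v
  have h6 : ∀ w, fderiv ℝ m (e, e) (v, w) = v + w := by
    intro w
    conv_rhs => rw [← h1 v, ← h2 w, ← map_add]
    simp
  exact (sub_eq_of_eq_add' (h6 _)).symm

/-- For `k b = b⁻¹ a b a⁻¹` one has `k (y b) = b⁻¹ k(y) (a b a⁻¹)`, so `k'(1) = Ad(a) - 1 = 0` makes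
`k` locally constant at `1`. The centralizer of `a` is then an open subgroup of a connected group.
-/
theorem mul_comm_of_chartAd_eq_one [ConnectedSpace G] (h : ∀ a : G, chartAd E a = .id ℝ E)
    (a b : G) : a * b = b * a := by
  have := topologicalGroup_of_lieGroup 𝓘(ℝ, E) ∞ (G := G)
  let φ := extChartAt 𝓘(ℝ, E) (1 : G)
  let k : G → G := fun b => b⁻¹ * (a * b * a⁻¹)
  have hk1 : k 1 = 1 := by simp [k]
  have hkc : Continuous k := by fun_prop
  have hsrc : ∀ᶠ b in 𝓝 (1 : G), k b ∈ φ.source :=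
    hkc.continuousAt ((isOpen_extChartAt_source (I := 𝓘(ℝ, E)) (1 : G)).mem_nhds (by
      rw [hk1]
      exact mem_extChartAt_source _))
  have hc := (contMDiffAt_chartOne_symm (E := E) (G := G)).continuousAt
  have hloc := eventually_eq_of_hasFDerivAt_zero (E := E) (f := fun b => φ (k b)) (by
    filter_upwards [hsrc] with b hb
    have hr : ContDiffAt ℝ ∞ (fun y => φ (b⁻¹ * φ.symm y * (a * b * a⁻¹)))
        (commChart a (chartOne E G)) := by
      rw [commChart_chartOne]
      refine ContMDiffAt.contDiffAt_extChartAt_comp 1 (ContMDiffAt.mul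
        (ContMDiffAt.mul contMDiffAt_const contMDiffAt_chartOne_symm) contMDiffAt_const) ?_
      rw [chartOne_symm, mul_one]
      exact hb
    have h1 := (hr.differentiableAt (by simp)).hasFDerivAt.comp _ (hasFDerivAt_commChart (E := E) a)
    rw [h, sub_self, ContinuousLinearMap.comp_zero] at h1
    refine h1.congr_of_eventuallyEq ?_
    have hs : ∀ᶠ y in 𝓝 (chartOne E G), k (φ.symm y) ∈ φ.source :=
      (hkc.continuousAt.comp hc) ((isOpen_extChartAt_source (I := 𝓘(ℝ, E)) (1 : G)).mem_nhds (by
        rw [Function.comp_apply, chartOne_symm, hk1]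
        exact mem_extChartAt_source _))
    filter_upwards [hs] with y hy
    have e1 : k (φ.symm y * b) = b⁻¹ * k (φ.symm y) * (a * b * a⁻¹) := by
      simp only [k]
      group
    simp only [Function.comp_apply]
    rw [e1, ← PartialEquiv.left_inv _ hy]
    rfl)
  have hcen : Subgroup.centralizer {a} = (⊤ : Subgroup G) := by
    refine Subgroup.eq_top_of_mem_nhds_one _ ?_
    filter_upwards [hloc, hsrc] with b h1 h2
    have h3 : k b = k 1 := φ.injOn h2 (by
      rw [hk1]
      exact mem_extChartAt_source _) h1
    rw [hk1] at h3
    have h4 : a * b * a⁻¹ = b := (inv_mul_eq_one.1 h3).symm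
    rw [SetLike.mem_coe, Subgroup.mem_centralizer_singleton_iff]
    exact (mul_inv_eq_iff_eq_mul.1 h4).symm
  have hb : b ∈ Subgroup.centralizer {a} := hcen ▸ Subgroup.mem_top b
  exact (Subgroup.mem_centralizer_singleton_iff.1 hb).symm

/-- Iterated commutators. -/
def iterComm {G : Type*} [Group G] : List G → G → G
  | [], b => b
  | a :: L, b => (iterComm L b)⁻¹ * (a * iterComm L b * a⁻¹)

theorem iterComm_mem_lowerCentralSeries {G : Type*} [Group G] (L : List G) (b : G) :
    iterComm L b ∈ (⊤ : Subgroup G).lowerCentralSeries L.length := by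
  induction L with
  | nil => simp
  | cons a L ih =>
    rw [List.length_cons, Subgroup.lowerCentralSeries_succ]
    refine Subgroup.subset_closure ⟨(iterComm L b)⁻¹, inv_mem ih, a, Subgroup.mem_top a, ?_⟩
    rw [iterComm, commutatorElement_def, inv_inv]
    group

variable (E) in
/-- The differential at `1` of an iterated commutator. -/
noncomputable def adProd (L : List G) : E →L[ℝ] E :=
  L.foldr (fun a f => (chartAd E a - .id ℝ E).comp f) (.id ℝ E)

theorem iterComm_one {G : Type*} [Group G] (L : List G) : iterComm L (1 : G) = 1 := by
  induction L with
  | nil => rfl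
  | cons a L ih => simp [iterComm, ih]

theorem hasFDerivAt_iterComm (L : List G) : HasFDerivAt
    (fun y => extChartAt 𝓘(ℝ, E) (1 : G) (iterComm L ((extChartAt 𝓘(ℝ, E) (1 : G)).symm y)))
    (adProd E L) (chartOne E G) := by
  have := topologicalGroup_of_lieGroup 𝓘(ℝ, E) ∞ (G := G)
  induction L with
  | nil =>
    refine (hasFDerivAt_id _).congr_of_eventuallyEq ?_
    filter_upwards [eventually_mem_target (E := E) (G := G)] with y hy
    rw [iterComm, PartialEquiv.right_inv _ hy, id]
  | cons a L ih =>
    have h1 := hasFDerivAt_commChart (E := E) a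
    have he : chartOne E G = extChartAt 𝓘(ℝ, E) (1 : G)
        (iterComm L ((extChartAt 𝓘(ℝ, E) (1 : G)).symm (chartOne E G))) := by
      rw [chartOne_symm, iterComm_one]
      rfl
    rw [he] at h1
    refine (HasFDerivAt.comp (f := fun y => extChartAt 𝓘(ℝ, E) (1 : G)
      (iterComm L ((extChartAt 𝓘(ℝ, E) (1 : G)).symm y))) _ h1 ih).congr_of_eventuallyEq ?_
    have hc : Continuous (iterComm L) := by
      clear * - this
      induction L with
      | nil => exact continuous_id
      | cons a L ih => exact ih.inv.mul ((continuous_const.mul ih).mul continuous_const)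
    have hs : ∀ᶠ y in 𝓝 (chartOne E G), iterComm L ((extChartAt 𝓘(ℝ, E) (1 : G)).symm y)
        ∈ (extChartAt 𝓘(ℝ, E) (1 : G)).source :=
      (hc.continuousAt.comp (contMDiffAt_chartOne_symm (E := E) (G := G)).continuousAt)
        ((isOpen_extChartAt_source (I := 𝓘(ℝ, E)) (1 : G)).mem_nhds (by
          rw [Function.comp_apply, chartOne_symm, iterComm_one]
          exact mem_extChartAt_source _))
    filter_upwards [hs] with y hy
    rw [Function.comp_apply, commChart, PartialEquiv.left_inv _ hy, iterComm]

/-- An iterated commutator as long as the lower central series is constantly `1`, so its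
differential vanishes. This carries nilpotency over to `Ad` directly from the group. -/
theorem exists_adProd_eq_zero [Group.IsNilpotent G] :
    ∃ n, ∀ L : List G, L.length = n → adProd E L = 0 := by
  obtain ⟨n, hn⟩ := Subgroup.nilpotent_iff_lowerCentralSeries.1 ‹Group.IsNilpotent G›
  refine ⟨n, fun L hL => (hasFDerivAt_iterComm L).unique ?_⟩
  refine (hasFDerivAt_const (chartOne E G) (chartOne E G)).congr_of_eventuallyEq
    (Eventually.of_forall fun y => ?_)
  have := iterComm_mem_lowerCentralSeries L ((extChartAt 𝓘(ℝ, E) (1 : G)).symm y)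
  rw [hL, hn, Subgroup.mem_bot] at this
  beta_reduce
  rw [this]
  rfl

/-- The Lie algebra of a connected non-abelian nilpotent Lie group has a nonzero `Ad`-invariant
element of the form `Ad(a) W - W`. -/
theorem exists_chartAd_invariant [ConnectedSpace G] [Group.IsNilpotent G]
    (hG : ¬ ∀ a b : G, a * b = b * a) :
    ∃ (a : G) (W Z : E), Z ≠ 0 ∧ chartAd E a W - W = Z ∧ ∀ b : G, chartAd E b Z = Z := by
  classical
  have hex := exists_adProd_eq_zero (E := E) (G := G)
  have hmin := fun m => Nat.find_min hex (m := m)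
  have hspec := Nat.find_spec hex
  have key : ∀ n, Nat.find hex = n + 1 → ∃ L : List G, L.length = n ∧ adProd E L ≠ 0 := by
    intro n hn
    have := hmin n (by omega)
    push Not at this
    exact this
  have hne : ∃ a : G, chartAd E a ≠ .id ℝ E := by
    by_contra hcon
    push Not at hcon
    exact hG (mul_comm_of_chartAd_eq_one hcon)
  obtain ⟨a, ha⟩ := hne
  have ha' : adProd E [a] ≠ 0 := by
    intro h0
    refine ha (sub_eq_zero.1 ?_)
    simpa [adProd] using h0
  -- If all products of length `0` or of length `1` vanished, then `Ad(a) - 1` would be zero. Hence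
  -- a longest nonzero product has at least one factor.
  obtain ⟨n, hn⟩ : ∃ n, Nat.find hex = n + 2 := by
    match hfind : Nat.find hex with
    | 0 =>
      have h0 := hspec [] (by simp [hfind])
      refine absurd ?_ ha'
      change (chartAd E a - .id ℝ E).comp (adProd E []) = 0
      rw [h0, ContinuousLinearMap.comp_zero]
    | 1 => exact absurd (hspec [a] (by simp [hfind])) ha'
    | n + 2 => exact ⟨n, rfl⟩
  obtain ⟨L, hL, hL0⟩ := key (n + 1) hn
  match L, hL with
  | b :: L, hL =>
    obtain ⟨v, hv⟩ : ∃ v, adProd E (b :: L) v ≠ 0 := by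
      by_contra hcon
      push Not at hcon
      exact hL0 (ContinuousLinearMap.ext hcon)
    refine ⟨b, adProd E L v, adProd E (b :: L) v, hv, rfl, fun d => ?_⟩
    have h1 := hspec (d :: b :: L) (by simp [hn] at hL ⊢; exact hL)
    have h2 := congrArg (fun f => f v) h1
    exact sub_eq_zero.1 h2

/-- Differentiate the constant function `b ↦ Ad(b) Z` at the identity. -/
theorem chartBracket_eq_zero_of_chartAd_invariant [FiniteDimensional ℝ E] {Z : E}
    (hZ : ∀ b : G, chartAd E b Z = Z) (V : E) : chartBracket E G Z V = 0 := by
  have h1 := (hasFDerivAt_chartAd (E := E) (G := G)).clm_apply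
    (hasFDerivAt_const Z (chartOne E G))
  simp only [hZ] at h1
  have h2 := congrArg (fun f => f V) (h1.unique (hasFDerivAt_const Z (chartOne E G)))
  rw [chartBracket_anti]
  simpa using h2

/-- A linear form vanishing on all brackets is `Ad`-invariant. -/
theorem apply_chartAd_of_chartBracket [FiniteDimensional ℝ E] [ConnectedSpace G] (l : E →L[ℝ] ℝ)
    (hl : ∀ U V, l (chartBracket E G U V) = 0) (a : G) (W : E) : l (chartAd E a W) = l W := by
  have := topologicalGroup_of_lieGroup 𝓘(ℝ, E) ∞ (G := G)
  let S : Subgroup G :=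
    { carrier := {a | l.comp (chartAd E a) = l}
      one_mem' := by
        rw [Set.mem_ofPred_eq, chartAd_one, ContinuousLinearMap.comp_id]
      mul_mem' := by
        intro a b ha hb
        rw [Set.mem_ofPred_eq] at *
        rw [chartAd_mul, ← ContinuousLinearMap.comp_assoc, ha, hb]
      inv_mem' := by
        intro a ha
        rw [Set.mem_ofPred_eq] at *
        conv_lhs => rw [← ha]
        rw [ContinuousLinearMap.comp_assoc, ← chartAd_mul, mul_inv_cancel, chartAd_one,
          ContinuousLinearMap.comp_id] }
  have hS : S = ⊤ := by
    -- The derivative of `y ↦ l ∘ Ad(y a)` at `y = 1` is `l ∘ ad(·) ∘ Ad(a) = 0`, so the stabilizer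
    -- `S` of `l` contains a neighbourhood of `1`.
    refine S.eq_top_of_mem_nhds_one ?_
    have := eventually_eq_of_hasFDerivAt_zero (E := E) (f := fun a : G => l.comp (chartAd E a))
      (Eventually.of_forall fun a => by
        simp only [chartAd_mul]
        have := (hasFDerivAt_const l (chartOne E G)).clm_comp
          ((hasFDerivAt_chartAd (E := E) (G := G)).clm_comp
            (hasFDerivAt_const (chartAd E a) (chartOne E G)))
        refine this.congr_fderiv ?_
        ext
        simp [hl])
    filter_upwards [this] with a ha
    rw [chartAd_one, ContinuousLinearMap.comp_id] at ha
    exact ha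
  have ha : a ∈ S := hS ▸ Subgroup.mem_top a
  exact congrArg (fun f => f W) (show l.comp (chartAd E a) = l from ha)

end AdjointRepresentation

/-! ### Curvature of left-invariant metrics -/

section LeftInvariantMetrics

variable {E : Type*} [NormedAddCommGroup E] [NormedSpace ℝ E]
  {G : Type*} [TopologicalSpace G] [ChartedSpace E G]

theorem LinearMap.linearIndependent_pair_iff {f : E →ₗ[ℝ] E} (hf : Function.Injective f) (v w : E) :
    LinearIndependent ℝ ![f v, f w] ↔ LinearIndependent ℝ ![v, w] := by
  rw [← f.linearIndependent_iff (v := ![v, w]) (LinearMap.ker_eq_bot.2 hf)]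
  have : f ∘ ![v, w] = ![f v, f w] := by
    ext i
    fin_cases i <;> rfl
  rw [this]

theorem linearIndependent_chartVec [IsManifold 𝓘(ℝ, E) ∞ G] {x : G} {v w : TangentSpace 𝓘(ℝ, E) x} :
    LinearIndependent ℝ ![chartVec x v, chartVec x w] ↔ LinearIndependent ℝ ![v, w] := by
  let L : E →L[ℝ] E := mfderiv 𝓘(ℝ, E) 𝓘(ℝ, E) (extChartAt 𝓘(ℝ, E) x) x
  have hL : Function.Injective L := (chartVec_bijective (E := E) x).injective
  have h : ∀ v w : E, LinearIndependent ℝ ![L v, L w] ↔ LinearIndependent ℝ ![v, w] :=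
    LinearMap.linearIndependent_pair_iff (f := L.toLinearMap) hL
  exact h v w

theorem gram_pos {B : E →L[ℝ] E →L[ℝ] ℝ} (symm : ∀ v w, B v w = B w v)
    (pos : ∀ v, v ≠ 0 → 0 < B v v) {U V : E} (h : LinearIndependent ℝ ![U, V]) :
    0 < B U U * B V V - B U V ^ 2 := by
  have hU : U ≠ 0 := h.ne_zero 0
  have h1 := pos U hU
  -- The component of `V` orthogonal to `U`, scaled by `B U U`; its square norm is `B U U` times the
  -- Gram determinant.
  have h2 := pos (B U U • V - B U V • U) fun h0 => by
    have := LinearIndependent.pair_iff.1 h (-B U V) (B U U) (by rw [← h0, neg_smul]; abel)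
    exact h1.ne' this.2
  simp only [map_sub, sub_apply, map_smul, smul_apply, smul_eq_mul, symm V U] at h2
  have h3 : 0 < B U U * (B U U * B V V - B U V ^ 2) := by nlinarith
  exact (mul_pos_iff_of_pos_left h1).1 h3

variable [Group G] [LieGroup 𝓘(ℝ, E) ∞ G] {g : RiemMetric E G}

theorem lieGroupSpace_toTangent (hg : g.IsInvariant G) (Y : GroupLieAlgebra 𝓘(ℝ, E) G) :
    (lieGroupSpace g hg).toTangent Y = Y :=
  congrArg (fun L => L Y) (orbitDeriv_one (E := E) (G := G))

theorem lieGroupSpace_H (hg : g.IsInvariant G) : (lieGroupSpace g hg).H = ⊥ := by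
  ext a
  rw [Subgroup.mem_bot]
  change a * 1 = 1 ↔ a = 1
  rw [mul_one]

theorem zero_mem_lieGroupSpace_V (hg : g.IsInvariant G) : 0 ∈ (lieGroupSpace g hg).V :=
  ⟨Submodule.zero_mem _, fun _ _ => map_zero _, by simp⟩

theorem lieGroupSpace_randersFn_zero (hg : g.IsInvariant G) (x : G) (y : TangentSpace 𝓘(ℝ, E) x) :
    (lieGroupSpace g hg).randersFn 0 x y = √(g.inner x y y) := by
  have h0 : (lieGroupSpace g hg).invariantField 0 x = 0 := by
    simp only [ReductiveHomogeneousSpace.invariantField, map_zero]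
    exact map_zero (M := E) (N := E) _
  have h1 : g.inner x ((lieGroupSpace g hg).invariantField 0 x) y = 0 := by
    rw [h0, map_zero]
    rfl
  change √(g.inner x y y) + g.inner x ((lieGroupSpace g hg).invariantField 0 x) y = _
  rw [h1, add_zero]

/-- Since `𝔥 = 0`, the projection in the numerator vanishes. No bracket other than `⁅0, Y⁆` has to
be evaluated. -/
theorem lieGroupSpace_dengHou (hg : g.IsInvariant G) (Y U : GroupLieAlgebra 𝓘(ℝ, E) G) :
    (lieGroupSpace g hg).dengHou 0 Y U = 0 := by
  have h0 : ∀ v, (lieGroupSpace g hg).projH v = 0 := by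
    intro v
    have h1 : (lieGroupSpace g hg).projH v ∈ (lieGroupSpace g hg).h :=
      Submodule.projection_apply_mem _ v
    have h2 : (lieGroupSpace g hg).h = ⊥ := by
      change LinearMap.ker (orbitDeriv (E := E) (G := G) (E' := E) (1 : G)) = ⊥
      rw [orbitDeriv_one, LinearMap.ker_id]
    rwa [h2, Submodule.mem_bot] at h1
  have h1 : ⁅(0 : GroupLieAlgebra 𝓘(ℝ, E) G), Y⁆ = 0 := by
    rw [GroupLieAlgebra.bracket_def]
    have : mulInvariantVectorField (0 : GroupLieAlgebra 𝓘(ℝ, E) G) = 0 := by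
      ext x
      exact map_zero _
    rw [this, VectorField.mlieBracket_zero_left]
    rfl
  rw [ReductiveHomogeneousSpace.dengHou, h0, h1]
  simp

variable [FiniteDimensional ℝ E]

/-- The value depends on the frame components alone and not on `x`, which transports vanishing at
`1` to every point. -/
theorem sectionalCurvature_eq_of_leftFrame (hg : g.IsInvariant G) {x : G}
    {v w : TangentSpace 𝓘(ℝ, E) x} {V W : E}
    (hv : leftFrame x (extChartAt 𝓘(ℝ, E) x x) V = chartVec x v)
    (hw : leftFrame x (extChartAt 𝓘(ℝ, E) x x) W = chartVec x w) :
    sectionalCurvature g x v w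
      = coordMetric g 1 (chartOne E G)
          (koszulCurvature (coordMetric g 1 (chartOne E G)) (chartBracket E G) V W W) V
        / (coordMetric g 1 (chartOne E G) V V * coordMetric g 1 (chartOne E G) W W
          - coordMetric g 1 (chartOne E G) V W ^ 2) := by
  have h := (isInvariantFrame_leftFrame hg
    (mem_extChartAt_target (I := 𝓘(ℝ, E)) x)).coordSectionalCurvature_eq
    (coordMetric_symm g 1 (chartOne E G)) (coordMetric_pos g 1 (chartOne_mem E G)) V W
  rw [hv, hw] at h
  exact h

theorem sectionalCurvature_one (hg : g.IsInvariant G) (v w : TangentSpace 𝓘(ℝ, E) (1 : G)) :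
    sectionalCurvature g 1 v w
      = coordMetric g 1 (chartOne E G) (koszulCurvature (coordMetric g 1 (chartOne E G))
          (chartBracket E G) (chartVec 1 v) (chartVec 1 w) (chartVec 1 w)) (chartVec 1 v)
        / (coordMetric g 1 (chartOne E G) (chartVec 1 v) (chartVec 1 v)
          * coordMetric g 1 (chartOne E G) (chartVec 1 w) (chartVec 1 w)
          - coordMetric g 1 (chartOne E G) (chartVec 1 v) (chartVec 1 w) ^ 2) :=
  sectionalCurvature_eq_of_leftFrame hg
    (congrArg (fun L : E →L[ℝ] E => L (chartVec 1 v)) (leftFrame_one (E := E) (G := G)))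
    (congrArg (fun L : E →L[ℝ] E => L (chartVec 1 w)) (leftFrame_one (E := E) (G := G)))

/-- If all sectional curvatures of a left-invariant metric at the identity vanish, then all
sectional curvatures vanish. -/
theorem sectionalCurvature_eq_zero (hg : g.IsInvariant G)
    (flat : ∀ v w : TangentSpace 𝓘(ℝ, E) (1 : G), LinearIndependent ℝ ![v, w] →
      sectionalCurvature g 1 v w = 0)
    {x : G} {v w : TangentSpace 𝓘(ℝ, E) x} (h : LinearIndependent ℝ ![v, w]) :
    sectionalCurvature g x v w = 0 := by
  have hx := (isInvariantFrame_leftFrame hg (mem_extChartAt_target (I := 𝓘(ℝ, E)) x)).isInvertible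
  have hv := hx.self_apply_inverse (chartVec x v)
  have hw := hx.self_apply_inverse (chartVec x w)
  obtain ⟨v₁, hv₁⟩ := (chartVec_bijective (E := E) (1 : G)).surjective
    ((leftFrame x (extChartAt 𝓘(ℝ, E) x x)).inverse (chartVec x v))
  obtain ⟨w₁, hw₁⟩ := (chartVec_bijective (E := E) (1 : G)).surjective
    ((leftFrame x (extChartAt 𝓘(ℝ, E) x x)).inverse (chartVec x w))
  rw [sectionalCurvature_eq_of_leftFrame hg hv hw, ← hv₁, ← hw₁, ← sectionalCurvature_one hg]
  refine flat v₁ w₁ (linearIndependent_chartVec.1 ?_)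
  rw [← linearIndependent_chartVec, ← hv, ← hw, ← hv₁, ← hw₁] at h
  exact (LinearMap.linearIndependent_pair_iff
    (f := (leftFrame x (extChartAt 𝓘(ℝ, E) x x)).toLinearMap)
    (leftFrame_injective (mem_extChartAt_target x)) _ _).1 h

/-- A left-invariant metric on a connected non-abelian nilpotent Lie group is not flat. -/
theorem exists_sectionalCurvature_ne_zero [ConnectedSpace G] [Group.IsNilpotent G]
    (hG : ¬ ∀ a b : G, a * b = b * a) (hg : g.IsInvariant G) :
    ∃ Y U : TangentSpace 𝓘(ℝ, E) (1 : G), LinearIndependent ℝ ![Y, U] ∧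
      sectionalCurvature g 1 Y U ≠ 0 := by
  by_contra! flat
  obtain ⟨a, W, Z, hZ, hW, hinv⟩ := exists_chartAd_invariant (E := E) hG
  have symm := coordMetric_symm g 1 (chartOne E G)
  have pos := coordMetric_pos g 1 (chartOne_mem E G)
  have hbr := apply_bracket_eq_zero_of_flat symm pos chartBracket_anti
    (chartBracket_eq_zero_of_chartAd_invariant hinv) (fun U hU => by
      obtain ⟨z, hz⟩ := (chartVec_bijective (E := E) (1 : G)).surjective Z
      obtain ⟨u, hu⟩ := (chartVec_bijective (E := E) (1 : G)).surjective U
      rw [← hz, ← hu] at hU ⊢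
      have h0 := flat z u (linearIndependent_chartVec.1 hU)
      rw [sectionalCurvature_one hg, div_eq_zero_iff] at h0
      exact h0.resolve_right (gram_pos symm pos hU).ne')
  -- The form `⟨·, Z⟩` is `Ad`-invariant, so it vanishes on `Z = Ad(a) W - W`.
  have h1 := apply_chartAd_of_chartBracket ((coordMetric g 1 (chartOne E G)).flip Z) hbr a W
  have h2 : coordMetric g 1 (chartOne E G) Z Z = 0 := by
    nth_rw 1 [← hW]
    rw [map_sub, sub_apply]
    exact sub_eq_zero.2 h1
  exact (pos Z hZ).ne' h2

theorem flagCurvature_eq_sectionalCurvature (hg : g.IsInvariant G)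
    (Y U : GroupLieAlgebra 𝓘(ℝ, E) G) :
    flagCurvature ((lieGroupSpace g hg).randersFn 0) (1 : G) Y U = sectionalCurvature g (1 : G) Y U :=
  (isInvariantFrame_leftFrame hg (mem_extChartAt_target (I := 𝓘(ℝ, E)) (1 : G))).coordFlagCurvature_eq
    (coordMetric_symm g 1 (chartOne E G)) (coordMetric_pos g 1 (chartOne_mem E G)) chartBracket_anti
    -- `F² = g` is needed at all `z`, including those outside the chart, where the differential of
    -- the inverse chart may kill nonzero vectors.
    (fun z v => by
      rw [lieGroupSpace_randersFn_zero]
      refine Real.sq_sqrt ?_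
      by_cases h : (chartSymmDeriv (1 : G) z v : E) = 0
      · have h' : chartSymmDeriv (1 : G) z v = 0 := h
        rw [h', map_zero]
      · exact (g.pos _ _ h).le) _ _

theorem sectionalCurvature_eq_zero_of_flagFormula (hg : g.IsInvariant G)
    (h : (lieGroupSpace g hg).FlagFormula 0) (Y U : GroupLieAlgebra 𝓘(ℝ, E) G)
    (hYU : LinearIndependent ℝ ![Y, U]) : sectionalCurvature g (1 : G) Y U = 0 := by
  have h1 := h Y Submodule.mem_top U Submodule.mem_top hYU
  rw [lieGroupSpace_dengHou, lieGroupSpace_toTangent, lieGroupSpace_toTangent] at h1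
  exact (flagCurvature_eq_sectionalCurvature hg Y U).symm.trans h1

theorem not_flagFormula [ConnectedSpace G] [Group.IsNilpotent G]
    (hG : ¬ ∀ a b : G, a * b = b * a) (hg : g.IsInvariant G) :
    ¬ (lieGroupSpace g hg).FlagFormula 0 := by
  intro h
  obtain ⟨Y, U, hYU, hne⟩ := exists_sectionalCurvature_ne_zero hG hg
  exact hne (sectionalCurvature_eq_zero_of_flagFormula hg h Y U hYU)

end LeftInvariantMetrics

/-! ### The Heisenberg group and a left-invariant metric on it -/

namespace Heisenberg

open scoped InnerProductSpace commutatorElement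

instance : ConnectedSpace Heisenberg :=
  inferInstanceAs (ConnectedSpace (EuclideanSpace ℝ (Fin 3)))

instance : T2Space Heisenberg := inferInstanceAs (T2Space (EuclideanSpace ℝ (Fin 3)))

theorem commutator_mem_center (p q : Heisenberg) : ⁅p, q⁆ ∈ Subgroup.center Heisenberg := by
  rw [Subgroup.mem_center_iff]
  intro r
  rw [commutatorElement_def]
  change mulFn r (mulFn (mulFn (mulFn p q) (invFn p)) (invFn q))
    = mulFn (mulFn (mulFn (mulFn p q) (invFn p)) (invFn q)) r
  ext i
  fin_cases i <;> simp [mulFn, invFn]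
  ring

instance : Group.IsNilpotent Heisenberg := by
  rw [Subgroup.nilpotent_iff_finite_descending_central_series]
  refine ⟨2, fun n => match n with | 0 => ⊤ | 1 => Subgroup.center _ | _ => ⊥, ⟨rfl, ?_⟩, rfl⟩
  intro x n hx q
  match n, hx with
  | 0, _ => exact commutator_mem_center x q
  | 1, hx =>
    rw [commutatorElement_eq_one_iff_mul_comm.2 (Subgroup.mem_center_iff.1 hx q).symm]
    exact Subgroup.one_mem _
  | n + 2, hx =>
    rw [Subgroup.mem_bot.1 hx, commutatorElement_one_left]
    exact Subgroup.one_mem _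

theorem not_commutative : ¬ ∀ a b : Heisenberg, a * b = b * a := by
  intro h
  have h1 : mulFn !₂[1, 0, 0] !₂[0, 1, 0] = mulFn !₂[0, 1, 0] !₂[1, 0, 0] := h _ _
  have h2 := congrArg (fun v : EuclideanSpace ℝ (Fin 3) => v 2) h1
  simp [mulFn] at h2

/-- The bilinear correction in the product of the Heisenberg group. -/
noncomputable def shear (p : EuclideanSpace ℝ (Fin 3)) :
    EuclideanSpace ℝ (Fin 3) →L[ℝ] EuclideanSpace ℝ (Fin 3) :=
  LinearMap.toContinuousLinearMap
    { toFun := fun v => !₂[0, 0, p 0 * v 1]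
      map_add' := by
        intro v w
        ext i
        fin_cases i <;> simp [mul_add]
      map_smul' := by
        intro c v
        ext i
        fin_cases i <;> simp [mul_left_comm] }

theorem shear_apply (p v : EuclideanSpace ℝ (Fin 3)) : shear p v = !₂[0, 0, p 0 * v 1] := rfl

theorem contDiff_shear : ContDiff ℝ ∞ shear := by
  rw [contDiff_clm_apply_iff]
  intro v
  rw [contDiff_euclidean]
  intro i
  fin_cases i <;> simp [shear_apply] <;> fun_prop

/-- The left-invariant inner product on the tangent space at `p`. -/
noncomputable def innerAt (p : EuclideanSpace ℝ (Fin 3)) :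
    EuclideanSpace ℝ (Fin 3) →L[ℝ] EuclideanSpace ℝ (Fin 3) →L[ℝ] ℝ :=
  (innerSL ℝ).bilinearComp (.id ℝ _ - shear p) (.id ℝ _ - shear p)

theorem innerAt_apply (p v w : EuclideanSpace ℝ (Fin 3)) :
    innerAt p v w = ⟪v - shear p v, w - shear p w⟫_ℝ := rfl

theorem contDiff_innerAt : ContDiff ℝ ∞ innerAt := by
  rw [contDiff_clm_apply_iff]
  intro v
  rw [contDiff_clm_apply_iff]
  intro w
  simp only [innerAt_apply]
  have := contDiff_shear
  exact ContDiff.inner ℝ (by fun_prop) (by fun_prop)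

/-- Consequently `1 - shear p` inverts `1 + shear p`, the differential of left multiplication by
`p`; this is why `innerAt` pulls back along `1 - shear p`. -/
theorem shear_shear (p v : EuclideanSpace ℝ (Fin 3)) : shear p (shear p v) = 0 := by
  ext i
  fin_cases i <;> simp [shear_apply]

theorem add_shear_sub_shear (p v : EuclideanSpace ℝ (Fin 3)) :
    (v - shear p v) + shear p (v - shear p v) = v := by
  rw [map_sub, shear_shear]
  abel

theorem innerAt_pos (p v : EuclideanSpace ℝ (Fin 3)) (hv : v ≠ 0) : 0 < innerAt p v v := by
  rw [innerAt_apply]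
  refine real_inner_self_pos.2 fun h => hv ?_
  rw [← add_shear_sub_shear p v, h, map_zero, add_zero]

theorem isVonNBounded_innerAt (p : EuclideanSpace ℝ (Fin 3)) :
    Bornology.IsVonNBounded ℝ {v | innerAt p v v < 1} := by
  refine ((NormedSpace.isVonNBounded_ball ℝ (EuclideanSpace ℝ (Fin 3)) 1).image
    (.id ℝ _ + shear p : EuclideanSpace ℝ (Fin 3) →L[ℝ] EuclideanSpace ℝ (Fin 3))).subset ?_
  intro v hv
  refine ⟨v - shear p v, ?_, add_shear_sub_shear p v⟩
  rw [Set.mem_ofPred_eq, innerAt_apply, real_inner_self_eq_norm_sq] at hv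
  rw [mem_ball_zero_iff]
  exact (sq_lt_one_iff₀ (norm_nonneg _)).1 hv

theorem hasFDerivAt_mulFn (a x : EuclideanSpace ℝ (Fin 3)) :
    HasFDerivAt (mulFn a) (.id ℝ _ + shear a) x := by
  have : mulFn a = fun y => a + (ContinuousLinearMap.id ℝ (EuclideanSpace ℝ (Fin 3)) + shear a) y := by
    ext y i
    fin_cases i <;> simp [mulFn, shear_apply, add_assoc]
  rw [this]
  exact ((ContinuousLinearMap.id ℝ (EuclideanSpace ℝ (Fin 3)) + shear a).hasFDerivAt).const_add a

/-- The tangent bundle of a vector space is trivialized by the identity, so smoothness of the metric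
as a section reduces to smoothness of `innerAt`. -/
theorem inCoordinates_innerAt (x₀ x : EuclideanSpace ℝ (Fin 3)) :
    ContinuousLinearMap.inCoordinates (σ := RingHom.id ℝ) (EuclideanSpace ℝ (Fin 3))
      (fun x : EuclideanSpace ℝ (Fin 3) => TangentSpace 𝓘(ℝ, EuclideanSpace ℝ (Fin 3)) x)
      (EuclideanSpace ℝ (Fin 3) →L[ℝ] ℝ)
      (fun x : EuclideanSpace ℝ (Fin 3) =>
        TangentSpace 𝓘(ℝ, EuclideanSpace ℝ (Fin 3)) x →L[ℝ] ℝ) x₀ x x₀ x (innerAt x)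
      = innerAt x := by
  ext v w
  simp only [ContinuousLinearMap.inCoordinates, ContinuousLinearMap.comp_apply,
    Bundle.Trivialization.continuousLinearMapAt_apply]
  rw [Bundle.Trivialization.linearMapAt_apply, if_pos (by simp; exact Set.mem_univ x),
    hom_trivializationAt_apply]
  simp [ContinuousLinearMap.inCoordinates]
  rfl

/-- The metric `innerAt` on the vector space underlying the Heisenberg group. -/
noncomputable def coordLeftInvariantMetric :
    Bundle.ContMDiffRiemannianMetric 𝓘(ℝ, EuclideanSpace ℝ (Fin 3)) ∞ (EuclideanSpace ℝ (Fin 3))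
      (fun x : EuclideanSpace ℝ (Fin 3) => TangentSpace 𝓘(ℝ, EuclideanSpace ℝ (Fin 3)) x) where
  inner p := innerAt p
  symm p v w := real_inner_comm (F := EuclideanSpace ℝ (Fin 3)) _ _
  pos p v hv := innerAt_pos p v hv
  isVonNBounded p := isVonNBounded_innerAt p
  contMDiff := by
    intro x
    refine (Bundle.contMDiffAt_section (IB := 𝓘(ℝ, EuclideanSpace ℝ (Fin 3))) (n := ∞)
      (F := EuclideanSpace ℝ (Fin 3) →L[ℝ] EuclideanSpace ℝ (Fin 3) →L[ℝ] ℝ)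
      (E := fun x : EuclideanSpace ℝ (Fin 3) => TangentSpace 𝓘(ℝ, EuclideanSpace ℝ (Fin 3)) x →L[ℝ]
        TangentSpace 𝓘(ℝ, EuclideanSpace ℝ (Fin 3)) x →L[ℝ] ℝ) x).2 ?_
    have h : ContMDiffAt 𝓘(ℝ, EuclideanSpace ℝ (Fin 3)) 𝓘(ℝ, EuclideanSpace ℝ (Fin 3) →L[ℝ]
      EuclideanSpace ℝ (Fin 3) →L[ℝ] ℝ) ∞ innerAt x := contDiff_innerAt.contDiffAt.contMDiffAt
    exact h.congr_of_eventuallyEq (Eventually.of_forall fun y => inCoordinates_innerAt x y)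

/-- A left-invariant Riemannian metric on the Heisenberg group. -/
noncomputable def leftInvariantMetric : RiemMetric (EuclideanSpace ℝ (Fin 3)) Heisenberg :=
  coordLeftInvariantMetric

/-- Shears add under the group product and compose to zero, hence `(1 - shear (a x)) (1 + shear a) =
1 - shear x`. -/
theorem innerAt_mulFn (a x u v : EuclideanSpace ℝ (Fin 3)) :
    innerAt (mulFn a x) (u + shear a u) (v + shear a v) = innerAt x u v := by
  have h2 : ∀ u, (u + shear a u) - shear (mulFn a x) (u + shear a u) = u - shear x u := by
    intro u
    ext i
    fin_cases i <;> simp [shear_apply, mulFn]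
    ring
  rw [innerAt_apply, innerAt_apply, h2, h2]

theorem isInvariant_leftInvariantMetric : leftInvariantMetric.IsInvariant Heisenberg := by
  intro a x v w
  have h := (hasFDerivAt_mulFn a x).hasMFDerivAt.mfderiv
  have hv := congrArg (fun L : EuclideanSpace ℝ (Fin 3) →L[ℝ] EuclideanSpace ℝ (Fin 3) => L v) h
  have hw := congrArg (fun L : EuclideanSpace ℝ (Fin 3) →L[ℝ] EuclideanSpace ℝ (Fin 3) => L w) h
  exact (congrArg₂ (fun v w : EuclideanSpace ℝ (Fin 3) => innerAt (mulFn a x) v w) hv hw).trans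
    (innerAt_mulFn a x v w)

end Heisenberg

/-! ### The main theorem -/

theorem mainTheorem2 :
    -- the formula is false
    ¬ DengHouAssertion ∧
    -- for `H = {e}` and `X = 0` the left-hand side is the sectional curvature, while the formula
    -- gives zero; so the formula would force all sectional curvatures to vanish
    (∀ (E : Type*) [NormedAddCommGroup E] [NormedSpace ℝ E] [FiniteDimensional ℝ E]
      (G : Type*) [TopologicalSpace G] [ChartedSpace E G] [Group G] [LieGroup 𝓘(ℝ, E) ∞ G]
      (g : RiemMetric E G) (hg : g.IsInvariant G),
      (lieGroupSpace g hg).H = ⊥ ∧ 0 ∈ (lieGroupSpace g hg).V ∧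
      (∀ Y U : GroupLieAlgebra 𝓘(ℝ, E) G, LinearIndependent ℝ ![Y, U] →
        flagCurvature ((lieGroupSpace g hg).randersFn 0) (1 : G) Y U
            = sectionalCurvature g (1 : G) Y U ∧
          (lieGroupSpace g hg).dengHou 0 Y U = 0) ∧
      ((lieGroupSpace g hg).FlagFormula 0 →
        ∀ (x : G) (v w : TangentSpace 𝓘(ℝ, E) x), LinearIndependent ℝ ![v, w] →
          sectionalCurvature g x v w = 0)) ∧
    -- connected non-abelian nilpotent Lie groups are counterexamples
    (∀ (E : Type*) [NormedAddCommGroup E] [NormedSpace ℝ E] [FiniteDimensional ℝ E]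
      (G : Type*) [TopologicalSpace G] [ChartedSpace E G] [Group G] [LieGroup 𝓘(ℝ, E) ∞ G]
      [ConnectedSpace G] [Group.IsNilpotent G],
      (¬ ∀ a b : G, a * b = b * a) →
      ∀ (g : RiemMetric E G) (hg : g.IsInvariant G),
        (∃ Y U : GroupLieAlgebra 𝓘(ℝ, E) G, LinearIndependent ℝ ![Y, U] ∧
          sectionalCurvature g (1 : G) Y U ≠ 0) ∧
        ¬ (lieGroupSpace g hg).FlagFormula 0) ∧
    -- the Heisenberg group is such a group, and it has left-invariant metrics
    (ConnectedSpace Heisenberg ∧ Group.IsNilpotent Heisenberg ∧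
      (¬ ∀ a b : Heisenberg, a * b = b * a) ∧
      ∃ g : RiemMetric (EuclideanSpace ℝ (Fin 3)) Heisenberg, g.IsInvariant Heisenberg) := by
  have heis := not_flagFormula Heisenberg.not_commutative
    Heisenberg.isInvariant_leftInvariantMetric
  refine ⟨fun h => heis (h _ _ _ _ _ 0 (zero_mem_lieGroupSpace_V _)), ?_, ?_,
    inferInstance, inferInstance, Heisenberg.not_commutative, _,
    Heisenberg.isInvariant_leftInvariantMetric⟩
  · intro E _ _ _ G _ _ _ _ g hg
    exact ⟨lieGroupSpace_H hg, zero_mem_lieGroupSpace_V hg,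
      fun Y U _ => ⟨flagCurvature_eq_sectionalCurvature hg Y U, lieGroupSpace_dengHou hg Y U⟩,
      fun h x v w hvw => sectionalCurvature_eq_zero hg
        (fun Y U hYU => sectionalCurvature_eq_zero_of_flagFormula hg h Y U hYU) hvw⟩
  · intro E _ _ _ G _ _ _ _ _ _ hG g hg
    exact ⟨exists_sectionalCurvature_ne_zero hG hg, not_flagFormula hG hg⟩
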